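/- Let $p=-\mathrm i\nabla$ in $L^2(\mathbb R^3)=L^2(\mathbb R^3;\mathbb C)$, and set $$A:=2+\frac{2^{3/2}}{\pi(\sqrt2-1)}.$$ For $\gamma\in(0,2/\pi)$ let $\sqrt{p^2+1}-1-\gamma/|x|$ denote the self-adjoint operator in $L^2(\mathbb R^3)$ defined as the Friedrichs extension of the corresponding quadratic form on $C_0^\infty(\mathbb R^3)$. For a function $m:[0,\infty)\to[0,\infty)$ write $\langle\psi,m(|p|)\psi\rangle=\int_{\mathbb R^3}m(|k|)\,|\hat\psi(k)|^2\,\mathrm dk$, where $\hat\psi$ is the unitary Fourier transform of $\psi$. Then for every $\gamma\in(0,2/\pi)$ and every eigenfunction $\psi$ of $\sqrt{p^2+1}-1-\gamma/|x|$, both of the following expectations are finite and $$\left\langle\psi,\left(\sqrt{p^2+1}-1\right)\psi\right\rangle\le\frac{\frac2\pi A}{\frac2\pi-\gamma}\left\langle\psi,\left(1-(p^2+1)^{-1/2}\right)\psi\right\rangle .$$ -/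

import Mathlib

open MeasureTheory Filter Topology
open scoped ComplexConjugate FourierTransform SchwartzMap

noncomputable section

namespace Chandrasekhar

/-! ### Friedrichs extensions -/

section Friedrichs

/-- Let `ι : D → H` embed a space `D` into a Hilbert space `H` and let `q` be a sesquilinear form on
`D` (antilinear in the first argument). A sequence `u` in `D` form-converges to `ψ ∈ H` if it
converges to `ψ` in `H` and is Cauchy with respect to the form. For a closable form `q` bounded
from below, the vectors `ψ` that admit such a sequence make up the domain of the closure of `q`. -/
def FormConverges {D H : Type*} [AddCommGroup D] [NormedAddCommGroup H] [InnerProductSpace ℂ H]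
    (ι : D → H) (q : D → D → ℂ) (u : ℕ → D) (ψ : H) : Prop :=
  Tendsto (fun n => ι (u n)) atTop (𝓝 ψ) ∧
    Tendsto (fun k : ℕ × ℕ => q (u k.1 - u k.2) (u k.1 - u k.2)) atTop (𝓝 0)

/-- The graph of the Friedrichs extension of the form `q` with core `D`, i.e. of the self-adjoint
operator `T` associated with the closure `q̄` of `q`: `ψ ∈ dom T` and `T ψ = f` mean that `ψ` is in
the domain of `q̄` and `q̄(φ, ψ) = ⟪φ, f⟫` for all `φ ∈ D`, where `q̄(φ, ψ) = lim q(φ, u n)` for a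
sequence `u` that form-converges to `ψ`. -/
def FriedrichsGraph {D H : Type*} [AddCommGroup D] [NormedAddCommGroup H] [InnerProductSpace ℂ H]
    (ι : D → H) (q : D → D → ℂ) (ψ f : H) : Prop :=
  ∃ u : ℕ → D, FormConverges ι q u ψ ∧
    ∀ φ : D, Tendsto (fun n => q φ (u n)) atTop (𝓝 (inner ℂ (ι φ) f))

/-- `ψ` is an eigenvector of the Friedrichs extension of `q`: `ψ ≠ 0`, `ψ` lies in the operator
domain, and `T ψ = E ψ` for some number `E`. -/
def IsFriedrichsEigenvector {D H : Type*} [AddCommGroup D] [NormedAddCommGroup H]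
    [InnerProductSpace ℂ H] (ι : D → H) (q : D → D → ℂ) (ψ : H) : Prop :=
  ψ ≠ 0 ∧ ∃ E : ℂ, FriedrichsGraph ι q ψ (E • ψ)

end Friedrichs

/-! ### The Chandrasekhar hydrogen operator -/

/-- Three-dimensional Euclidean space. -/
abbrev R3 : Type := EuclideanSpace ℝ (Fin 3)

/-- The Hilbert space `L²(ℝ³; ℂ)`. -/
abbrev L2R3 : Type := Lp ℂ 2 (volume : Measure R3)

/-- The space `C₀^∞(ℝ³; ℂ)`: the Schwartz functions of compact support are exactly the smooth
functions of compact support. -/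
def testFunctions : Submodule ℂ 𝓢(R3, ℂ) where
  carrier := {φ | HasCompactSupport (φ : R3 → ℂ)}
  add_mem' := fun hf hg => HasCompactSupport.add hf hg
  zero_mem' := HasCompactSupport.zero
  smul_mem' := fun c f hf => HasCompactSupport.smul_left (f := fun _ : R3 => c)
    (f' := (f : R3 → ℂ)) hf

/-- The inclusion of `C₀^∞(ℝ³)` into `L²(ℝ³)`. -/
def testToL2 (φ : testFunctions) : L2R3 := (φ : 𝓢(R3, ℂ)).toLp 2

/-- The modulus `|p|` of the momentum `p = -i∇` at the frequency `ξ`. Mathlib's Fourier transform is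
`𝓕 φ (ξ) = ∫ exp (-2πi x·ξ) φ(x) dx`, so that `p` acts as multiplication by `2πξ`. -/
def absMomentum (ξ : R3) : ℝ := 2 * Real.pi * ‖ξ‖

/-- The symbol `√(s² + 1) - 1` of the kinetic energy. -/
def kinetic (s : ℝ) : ℝ := Real.sqrt (s ^ 2 + 1) - 1

/-- The symbol `1 - (s² + 1)^{-1/2}`. -/
def kineticDefect (s : ℝ) : ℝ := 1 - (s ^ 2 + 1) ^ (-(1 / 2) : ℝ)

/-- The sesquilinear form `⟨φ, (√(p²+1) - 1 - γ/|x|) χ⟩` on `C₀^∞(ℝ³)`; both integrals converge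
absolutely. -/
def hydrogenForm (γ : ℝ) (φ χ : testFunctions) : ℂ :=
  (∫ ξ : R3, (kinetic (absMomentum ξ) : ℂ) *
      (conj (𝓕 (φ : 𝓢(R3, ℂ)) ξ) * 𝓕 (χ : 𝓢(R3, ℂ)) ξ)) -
    ∫ x : R3, ((γ / ‖x‖ : ℝ) : ℂ) * (conj ((φ : 𝓢(R3, ℂ)) x) * (χ : 𝓢(R3, ℂ)) x)

/-- `ψ` is an eigenfunction of `√(p²+1) - 1 - γ/|x|`, the Friedrichs extension in `L²(ℝ³)` of the
corresponding form on `C₀^∞(ℝ³)`. -/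
def IsHydrogenEigenfunction (γ : ℝ) (ψ : L2R3) : Prop :=
  IsFriedrichsEigenvector testToL2 (hydrogenForm γ) ψ

/-- The density whose integral is `⟨ψ, m(|p|) ψ⟩`. -/
def momentumDensity (m : ℝ → ℝ) (ψ : L2R3) (ξ : R3) : ℝ :=
  m (absMomentum ξ) * ‖(𝓕 ψ : L2R3) ξ‖ ^ 2

/-- The expectation `⟨ψ, m(|p|) ψ⟩` in the sense of quadratic forms, computed in momentum space
(meaningful when the density is integrable). -/
def momentumExpectation (m : ℝ → ℝ) (ψ : L2R3) : ℝ :=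
  ∫ ξ : R3, momentumDensity m ψ ξ

/-- The constant `A = 2 + 2^{3/2} / (π (√2 - 1))`. -/
def constA : ℝ := 2 + 2 ^ (3 / 2 : ℝ) / (Real.pi * (Real.sqrt 2 - 1))

end Chandrasekhar

end

noncomputable section

namespace Chandrasekhar

/-! ### Gaussian integrals and the Riesz composition of `|ξ|⁻²` with itself -/

/-! Everything takes place in momentum space. Let `f` be the Fourier transform of the eigenfunction,
with eigenvalue `e`, and let `K`, `D`, `N`, `B` stand for the kinetic energy, the kinetic defect,
the squared norm and the Coulomb form. Two facts carry the proof.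

The first is the virial theorem `virial`: `e N = -D`. It comes from testing the eigenvalue equation
against the dilate `f (r • ·)`, comparing with the dilated equation, dividing by `r - 1` and letting
`r` decrease to `1`. The symbol of the resulting multiplier is bounded uniformly in `r`, so strong
continuity of dilations in `L²` is all that is needed. In particular `e ≤ 0`.

The second is the sharp Kato inequality: `1/|x|` is form-bounded by `π/2 · |p|`. Here it is the
Schur test `lintegral_mul_coulombKernel_le`, resting on the convolution identity
`lintegral_riesz_comp`. It also makes the form coercive for `γ < 2/π`, which puts `f` in the space
`FiniteWeight` and lets the weak equation pass to the closure.

To conclude (`integral_kinetic_le`), split `f = g + h` at `|p| = 1`, test the equation with `g` and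
with `h`, and subtract. The cross terms cancel, `B(g, g) ≥ 0` can be dropped, and `B(h, h)` is
controlled by Kato and `|p| ≤ K + 2D`, valid for `|p| ≥ 1`. At low momenta `K ≤ 3/2 D`. With the
virial theorem this gives `(1 - γπ/2) K ≤ 4 D`, and `4 ≤ A`. -/

lemma lintegral_invSqrt_exp {c : ℝ} (hc : 0 < c) :
    ∫⁻ s in Set.Ioi (0 : ℝ), ENNReal.ofReal ((√s)⁻¹ * Real.exp (-(Real.pi * c * s))) =
      ENNReal.ofReal ((√c)⁻¹) := by
  have hr : 0 < Real.pi * c := by positivity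
  have h := Real.integral_rpow_mul_exp_neg_mul_Ioi (a := 1 / 2) (by norm_num) hr
  have hcongr : ∀ s ∈ Set.Ioi (0 : ℝ), s ^ ((1 / 2 : ℝ) - 1) * Real.exp (-(Real.pi * c * s)) =
      (√s)⁻¹ * Real.exp (-(Real.pi * c * s)) := by
    intro s hs
    rw [show ((1 / 2 : ℝ) - 1) = -(1 / 2) by norm_num, Real.rpow_neg (le_of_lt hs),
      ← Real.sqrt_eq_rpow]
  rw [setIntegral_congr_fun measurableSet_Ioi hcongr] at h
  have hval : (1 / (Real.pi * c)) ^ (1 / 2 : ℝ) * Real.Gamma (1 / 2) = (√c)⁻¹ := by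
    rw [Real.Gamma_one_half_eq, ← Real.sqrt_eq_rpow, one_div, Real.sqrt_inv,
      Real.sqrt_mul Real.pi_pos.le]
    have : √Real.pi ≠ 0 := (Real.sqrt_pos.2 Real.pi_pos).ne'
    field_simp
  rw [hval] at h
  rw [← h, ofReal_integral_eq_lintegral_ofReal]
  -- A nonintegrable function has Bochner integral `0`, so a nonzero value already proves
  -- integrability.
  · by_contra hn
    rw [integral_undef hn] at h
    have : 0 < (√c)⁻¹ := by positivity
    linarith
  · exact Eventually.of_forall fun s => by positivity

lemma lintegral_exp_neg {c : ℝ} (hc : 0 < c) :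
    ∫⁻ s in Set.Ioi (0 : ℝ), ENNReal.ofReal (Real.exp (-(Real.pi * c * s))) =
      ENNReal.ofReal (1 / (Real.pi * c)) := by
  have hr : 0 < Real.pi * c := by positivity
  have h := Real.integral_rpow_mul_exp_neg_mul_Ioi (a := 1) (by norm_num) hr
  simp only [sub_self, Real.rpow_zero, one_mul, Real.rpow_one, Real.Gamma_one, mul_one] at h
  rw [← h, ofReal_integral_eq_lintegral_ofReal]
  · by_contra hn
    rw [integral_undef hn] at h
    have : 0 < 1 / (Real.pi * c) := by positivity
    linarith
  · exact Eventually.of_forall fun s => by positivity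

/-- The substitution `t = s y²`, chosen so that a double integral over Gaussian parameters `s`, `t`
separates into `s` and the ratio `y`. -/
lemma lintegral_Ioi_comp_mul_sq {s : ℝ} (hs : 0 < s) (F : ℝ → ENNReal) :
    ∫⁻ t in Set.Ioi (0 : ℝ), F t =
      ∫⁻ y in Set.Ioi (0 : ℝ), ENNReal.ofReal (2 * s * y) * F (s * y ^ 2) := by
  have himg : (fun y : ℝ => s * y ^ 2) '' Set.Ioi 0 = Set.Ioi 0 := by
    ext t
    simp only [Set.mem_image, Set.mem_Ioi]
    constructor
    · rintro ⟨y, hy, rfl⟩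
      positivity
    · intro ht
      refine ⟨√(t / s), by positivity, ?_⟩
      rw [Real.sq_sqrt (by positivity)]
      field_simp
  have := lintegral_image_eq_lintegral_abs_deriv_mul (s := Set.Ioi (0 : ℝ))
    (f := fun y => s * y ^ 2) (f' := fun y => 2 * s * y) measurableSet_Ioi
    (fun y _ => by
      have := ((hasDerivAt_pow 2 y).const_mul s).hasDerivWithinAt (s := Set.Ioi (0 : ℝ))
      refine this.congr_deriv ?_
      push_cast; ring)
    (fun a ha b hb hab => by
      have h2 : a ^ 2 = b ^ 2 := mul_left_cancel₀ hs.ne' hab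
      exact (pow_left_inj₀ (le_of_lt ha) (le_of_lt hb) two_ne_zero).1 h2) F
  rw [himg] at this
  rw [this]
  refine setLIntegral_congr_fun measurableSet_Ioi fun y hy => ?_
  have hy' : (0 : ℝ) < y := hy
  simp only [abs_of_pos (show 0 < 2 * s * y by positivity)]

lemma integral_gaussian_R3 {a : ℝ} (ha : 0 < a) :
    ∫ q : R3, Real.exp (-(Real.pi * a) * ‖q‖ ^ 2) = ((√a)⁻¹) ^ 3 := by
  rw [GaussianFourier.integral_rexp_neg_mul_sq_norm (by positivity)]
  have h1 : Real.pi / (Real.pi * a) = a⁻¹ := by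
    have := Real.pi_pos.ne'
    field_simp
  rw [h1, ← Real.sqrt_inv, Real.sqrt_eq_rpow, ← Real.rpow_natCast, ← Real.rpow_mul (by positivity)]
  norm_num

lemma lintegral_gaussian_R3 {a : ℝ} (ha : 0 < a) :
    ∫⁻ q : R3, ENNReal.ofReal (Real.exp (-(Real.pi * a) * ‖q‖ ^ 2)) =
      ENNReal.ofReal (((√a)⁻¹) ^ 3) := by
  have h := integral_gaussian_R3 ha
  rw [← h, ofReal_integral_eq_lintegral_ofReal]
  · by_contra hn
    rw [integral_undef hn] at h
    have : 0 < ((√a)⁻¹) ^ 3 := by positivity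
    linarith
  · exact Eventually.of_forall fun s => by positivity

/-- Complete the square: the product is a Gaussian centred at `(t / (s + t)) • ξ` times a factor
independent of `q`. -/
lemma lintegral_gaussian_mul_gaussian {s t : ℝ} (hs : 0 < s) (ht : 0 < t) (ξ : R3) :
    ∫⁻ q : R3, ENNReal.ofReal (Real.exp (-(Real.pi * ‖q‖ ^ 2 * s))) *
        ENNReal.ofReal (Real.exp (-(Real.pi * ‖ξ - q‖ ^ 2 * t))) =
      ENNReal.ofReal (((√(s + t))⁻¹) ^ 3 *
        Real.exp (-(Real.pi * (s * t / (s + t)) * ‖ξ‖ ^ 2))) := by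
  have hst : 0 < s + t := by positivity
  have key : ∀ q : R3, ENNReal.ofReal (Real.exp (-(Real.pi * ‖q‖ ^ 2 * s))) *
        ENNReal.ofReal (Real.exp (-(Real.pi * ‖ξ - q‖ ^ 2 * t))) =
      ENNReal.ofReal (Real.exp (-(Real.pi * (s + t)) * ‖q - (t / (s + t)) • ξ‖ ^ 2)) *
      ENNReal.ofReal (Real.exp (-(Real.pi * (s * t / (s + t)) * ‖ξ‖ ^ 2))) := by
    intro q
    rw [← ENNReal.ofReal_mul (by positivity), ← ENNReal.ofReal_mul (by positivity),
      ← Real.exp_add, ← Real.exp_add]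
    congr 2
    rw [norm_sub_sq_real, norm_sub_sq_real, norm_smul, inner_smul_right, mul_pow,
      real_inner_comm ξ q, Real.norm_eq_abs, sq_abs]
    field_simp
    ring
  simp_rw [key]
  rw [lintegral_mul_const' _ _ ENNReal.ofReal_ne_top,
    lintegral_sub_right_eq_self (fun q : R3 =>
      ENNReal.ofReal (Real.exp (-(Real.pi * (s + t)) * ‖q‖ ^ 2))),
    lintegral_gaussian_R3 hst, ← ENNReal.ofReal_mul (by positivity)]

/-- Subordination to Gaussians, which reduces the convolution of two inverse squares to convolutions
of Gaussians. -/
lemma ofReal_inv_sq_eq_lintegral {r : ℝ} (hr : 0 < r) :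
    ENNReal.ofReal (1 / r ^ 2) = ENNReal.ofReal Real.pi *
      ∫⁻ s in Set.Ioi (0 : ℝ), ENNReal.ofReal (Real.exp (-(Real.pi * r ^ 2 * s))) := by
  rw [lintegral_exp_neg (by positivity), ← ENNReal.ofReal_mul Real.pi_pos.le]
  congr 1
  have := Real.pi_pos.ne'
  field_simp

lemma lintegral_Ioi_inv_one_add_sq :
    ∫⁻ y in Set.Ioi (0 : ℝ), ENNReal.ofReal ((1 + y ^ 2)⁻¹) = ENNReal.ofReal (Real.pi / 2) := by
  have h := integral_Ioi_inv_one_add_sq (i := 0)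
  rw [Real.arctan_zero, sub_zero] at h
  rw [← h, ofReal_integral_eq_lintegral_ofReal integrable_inv_one_add_sq.integrableOn]
  exact Eventually.of_forall fun s => by positivity

/-- The composition of the Riesz kernel `|ξ|⁻²` in `ℝ³` with itself. -/
lemma lintegral_riesz_comp {ξ : R3} (hξ : ξ ≠ 0) :
    ∫⁻ q : R3, ENNReal.ofReal (1 / ‖q‖ ^ 2) * ENNReal.ofReal (1 / ‖ξ - q‖ ^ 2) =
      ENNReal.ofReal (Real.pi ^ 3 / ‖ξ‖) := by
  have hr : 0 < ‖ξ‖ := norm_pos_iff.2 hξ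
  set e : ℝ → R3 → ENNReal := fun s q => ENNReal.ofReal (Real.exp (-(Real.pi * ‖q‖ ^ 2 * s)))
    with he
  have hae : ∀ᵐ q : R3, ENNReal.ofReal (1 / ‖q‖ ^ 2) * ENNReal.ofReal (1 / ‖ξ - q‖ ^ 2) =
      ENNReal.ofReal (Real.pi ^ 2) * ∫⁻ s in Set.Ioi (0 : ℝ), ∫⁻ t in Set.Ioi (0 : ℝ),
        e s q * e t (ξ - q) := by
    have h0 : ∀ᵐ q : R3, q ≠ 0 := by simp [ae_iff]
    have h1 : ∀ᵐ q : R3, q ≠ ξ := by simp [ae_iff]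
    filter_upwards [h0, h1] with q hq0 hq1
    rw [ofReal_inv_sq_eq_lintegral (norm_pos_iff.2 hq0),
      ofReal_inv_sq_eq_lintegral (norm_pos_iff.2 (sub_ne_zero.2 hq1.symm))]
    have : ∀ s : ℝ, ∫⁻ t in Set.Ioi (0 : ℝ), e s q * e t (ξ - q) =
        e s q * ∫⁻ t in Set.Ioi (0 : ℝ), e t (ξ - q) := fun s =>
      lintegral_const_mul' _ _ ENNReal.ofReal_ne_top
    simp_rw [this]
    rw [lintegral_mul_const _ (by simp only [he]; fun_prop), sq Real.pi,
      ENNReal.ofReal_mul Real.pi_pos.le]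
    ring
  rw [lintegral_congr_ae hae, lintegral_const_mul' _ _ ENNReal.ofReal_ne_top]
  have swap1 : ∫⁻ q : R3, ∫⁻ s in Set.Ioi (0 : ℝ), ∫⁻ t in Set.Ioi (0 : ℝ),
        e s q * e t (ξ - q) =
      ∫⁻ s in Set.Ioi (0 : ℝ), ∫⁻ t in Set.Ioi (0 : ℝ), ∫⁻ q : R3, e s q * e t (ξ - q) := by
    rw [lintegral_lintegral_swap]
    · refine lintegral_congr fun s => ?_
      rw [lintegral_lintegral_swap]
      simp only [he]; fun_prop
    · refine Measurable.aemeasurable ?_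
      have : Measurable (fun z : (R3 × ℝ) × ℝ => e z.1.2 z.1.1 * e z.2 (ξ - z.1.1)) := by
        simp only [he]; fun_prop
      exact this.lintegral_prod_right'
  rw [swap1]
  -- The Gaussian in `q` is integrated out, then `t = s y²` is substituted. What remains depends on
  -- `s` only through `s^(-1/2)` times an exponential.
  have inner1 : ∀ s ∈ Set.Ioi (0 : ℝ), ∫⁻ t in Set.Ioi (0 : ℝ), ∫⁻ q : R3, e s q * e t (ξ - q) =
      ∫⁻ y in Set.Ioi (0 : ℝ), ENNReal.ofReal (2 * y * ((√(1 + y ^ 2))⁻¹) ^ 3 *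
        ((√s)⁻¹ * Real.exp (-(Real.pi * (y ^ 2 / (1 + y ^ 2) * ‖ξ‖ ^ 2) * s)))) := by
    intro s hs
    have hs' : (0 : ℝ) < s := hs
    rw [setLIntegral_congr_fun measurableSet_Ioi
      (fun t ht => lintegral_gaussian_mul_gaussian hs ht ξ), lintegral_Ioi_comp_mul_sq hs]
    refine setLIntegral_congr_fun measurableSet_Ioi fun y hy => ?_
    have hy' : (0 : ℝ) < y := hy
    rw [← ENNReal.ofReal_mul (by positivity)]
    congr 1
    have e1 : √(s + s * y ^ 2) = √s * √(1 + y ^ 2) := by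
      rw [← Real.sqrt_mul hs'.le]; congr 1; ring
    have e2 : s * (s * y ^ 2) / (s + s * y ^ 2) * ‖ξ‖ ^ 2 =
        y ^ 2 / (1 + y ^ 2) * ‖ξ‖ ^ 2 * s := by
      field_simp
    rw [e1, mul_assoc Real.pi, e2, mul_assoc Real.pi (y ^ 2 / (1 + y ^ 2) * ‖ξ‖ ^ 2) s]
    have hs2 : s = √s ^ 2 := (Real.sq_sqrt hs'.le).symm
    have h3 : 0 < √s := Real.sqrt_pos.2 hs'
    have h4 : 0 < √(1 + y ^ 2) := by positivity
    set ex := Real.exp (-(Real.pi * (y ^ 2 / (1 + y ^ 2) * ‖ξ‖ ^ 2 * s)))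
    rw [show 2 * s * y = 2 * √s ^ 2 * y by rw [← hs2]]
    field_simp
  rw [setLIntegral_congr_fun measurableSet_Ioi inner1, lintegral_lintegral_swap]
  -- The `s`-integral cancels the factor `y` and one power of `√(1 + y²)`, leaving the derivative of
  -- the arctangent.
  · have inner2 : ∀ y ∈ Set.Ioi (0 : ℝ), ∫⁻ s in Set.Ioi (0 : ℝ),
        ENNReal.ofReal (2 * y * ((√(1 + y ^ 2))⁻¹) ^ 3 *
          ((√s)⁻¹ * Real.exp (-(Real.pi * (y ^ 2 / (1 + y ^ 2) * ‖ξ‖ ^ 2) * s)))) =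
        ENNReal.ofReal (2 / ‖ξ‖) * ENNReal.ofReal ((1 + y ^ 2)⁻¹) := by
      intro y hy
      have hy' : (0 : ℝ) < y := hy
      have : ∀ s : ℝ, ENNReal.ofReal (2 * y * ((√(1 + y ^ 2))⁻¹) ^ 3 *
          ((√s)⁻¹ * Real.exp (-(Real.pi * (y ^ 2 / (1 + y ^ 2) * ‖ξ‖ ^ 2) * s)))) =
          ENNReal.ofReal (2 * y * ((√(1 + y ^ 2))⁻¹) ^ 3) * ENNReal.ofReal
          ((√s)⁻¹ * Real.exp (-(Real.pi * (y ^ 2 / (1 + y ^ 2) * ‖ξ‖ ^ 2) * s))) := fun s =>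
        ENNReal.ofReal_mul (by positivity)
      simp_rw [this]
      rw [lintegral_const_mul' _ _ ENNReal.ofReal_ne_top, lintegral_invSqrt_exp (by positivity),
        ← ENNReal.ofReal_mul (by positivity), ← ENNReal.ofReal_mul (by positivity)]
      congr 1
      rw [Real.sqrt_mul (by positivity), Real.sqrt_div (by positivity), Real.sqrt_sq hr.le,
        Real.sqrt_sq hy'.le]
      have h4 : 0 < √(1 + y ^ 2) := by positivity
      rw [show (1 + y ^ 2)⁻¹ = (√(1 + y ^ 2) ^ 2)⁻¹ by rw [Real.sq_sqrt (by positivity)]]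
      field_simp
    rw [setLIntegral_congr_fun measurableSet_Ioi inner2,
      lintegral_const_mul' _ _ ENNReal.ofReal_ne_top, lintegral_Ioi_inv_one_add_sq,
      ← ENNReal.ofReal_mul (by positivity), ← ENNReal.ofReal_mul (by positivity)]
    congr 1
    field_simp
  · refine Measurable.aemeasurable ?_
    fun_prop

/-! ### The Coulomb form in momentum space -/

/-- The Fourier transform of `1/|x|`, as the kernel of a convolution operator. -/
def coulombKernel (p q : R3) : ℝ := 1 / (Real.pi * ‖p - q‖ ^ 2)

/-- The square of the homogeneous Sobolev norm of order `1/2`, up to a factor `2π`. -/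
def weightNorm (f : R3 → ℂ) : ENNReal := ∫⁻ ξ, ENNReal.ofReal ‖ξ‖ * ‖f ξ‖ₑ ^ 2

/-- Measurable functions with finite homogeneous Sobolev norm of order `1/2`. -/
def FiniteWeight (f : R3 → ℂ) : Prop := AEStronglyMeasurable f volume ∧ weightNorm f < ⊤

/-- The sesquilinear form of `1/|x|` in momentum space. -/
def coulombForm (f g : R3 → ℂ) : ℂ :=
  ∫ z : R3 × R3, conj (f z.1) * g z.2 * (coulombKernel z.1 z.2 : ℂ)

/-- Multiplication by `1/|x|` in momentum space. -/
def coulombConv (g : R3 → ℂ) (p : R3) : ℂ := ∫ q : R3, g q * (coulombKernel p q : ℂ)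

lemma coulombKernel_nonneg (p q : R3) : 0 ≤ coulombKernel p q := by
  unfold coulombKernel; positivity

lemma coulombKernel_comm (p q : R3) : coulombKernel p q = coulombKernel q p := by
  simp only [coulombKernel, norm_sub_rev]

@[fun_prop]
lemma measurable_coulombKernel : Measurable (fun z : R3 × R3 => coulombKernel z.1 z.2) := by
  unfold coulombKernel; fun_prop

lemma ae_ne_zero_R3 : ∀ᵐ q : R3, q ≠ 0 := by simp [ae_iff]

lemma lintegral_sq_mul_rpow_half {α : Type*} [MeasurableSpace α] {μ : Measure α}
    {F G : α → ENNReal} (hF : AEMeasurable F μ) (hG : AEMeasurable G μ) :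
    ∫⁻ a, F a * G a ∂μ ≤ (∫⁻ a, F a ^ 2 ∂μ) ^ (1 / 2 : ℝ) * (∫⁻ a, G a ^ 2 ∂μ) ^ (1 / 2 : ℝ) := by
  have := ENNReal.lintegral_mul_le_Lp_mul_Lq μ Real.HolderConjugate.two_two hF hG
  simpa using this

/-- One Cauchy–Schwarz factor of the Schur test. The `q`-integral of `|q|⁻² |p - q|⁻²` is `π³/|p|`,
which combines with `|p|²/π` to give exactly `π² |p|`. -/
lemma lintegral_schur_weight {f : R3 → ENNReal} (hf : AEMeasurable f) :
    ∫⁻ z : R3 × R3, (f z.1 * ENNReal.ofReal (‖z.1‖ / ‖z.2‖ * √(coulombKernel z.1 z.2))) ^ 2 =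
      ENNReal.ofReal (Real.pi ^ 2) * ∫⁻ p, ENNReal.ofReal ‖p‖ * f p ^ 2 := by
  have hmeas : Measurable (fun z : R3 × R3 =>
      ENNReal.ofReal (‖z.1‖ / ‖z.2‖ * √(coulombKernel z.1 z.2))) := by fun_prop
  rw [Measure.volume_eq_prod, lintegral_prod _ (by
    exact ((hf.comp_quasiMeasurePreserving Measure.quasiMeasurePreserving_fst).mul
      hmeas.aemeasurable).pow_const 2), ← lintegral_const_mul' _ _ ENNReal.ofReal_ne_top]
  refine lintegral_congr_ae ?_
  filter_upwards [ae_ne_zero_R3] with p hp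
  have hp' : 0 < ‖p‖ := norm_pos_iff.2 hp
  have : ∀ q : R3, (f p * ENNReal.ofReal (‖p‖ / ‖q‖ * √(coulombKernel p q))) ^ 2 =
      (f p ^ 2 * ENNReal.ofReal (‖p‖ ^ 2 / Real.pi)) *
        (ENNReal.ofReal (1 / ‖q‖ ^ 2) * ENNReal.ofReal (1 / ‖p - q‖ ^ 2)) := by
    intro q
    rw [mul_pow, mul_assoc, ← ENNReal.ofReal_mul (by positivity), ← ENNReal.ofReal_mul
      (by positivity), ← ENNReal.ofReal_pow (by positivity), mul_pow,
      Real.sq_sqrt (coulombKernel_nonneg p q)]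
    congr 2
    unfold coulombKernel
    rw [div_pow, div_mul_div_comm, div_mul_div_comm, div_mul_div_comm]
    congr 1 <;> ring
  simp_rw [this]
  rw [lintegral_const_mul _ (by fun_prop), lintegral_riesz_comp hp, mul_assoc,
    ← ENNReal.ofReal_mul (by positivity), ← mul_assoc, ← ENNReal.ofReal_mul (by positivity),
    mul_comm]
  congr 2
  have := Real.pi_pos.ne'
  field_simp

/-- The sharp Kato inequality, in the form of a Schur test in momentum space. -/
lemma lintegral_mul_coulombKernel_le {f g : R3 → ENNReal} (hf : AEMeasurable f)
    (hg : AEMeasurable g) :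
    ∫⁻ z : R3 × R3, f z.1 * g z.2 * ENNReal.ofReal (coulombKernel z.1 z.2) ≤
      ENNReal.ofReal (Real.pi ^ 2) * ((∫⁻ p, ENNReal.ofReal ‖p‖ * f p ^ 2) ^ (1 / 2 : ℝ) *
        (∫⁻ p, ENNReal.ofReal ‖p‖ * g p ^ 2) ^ (1 / 2 : ℝ)) := by
  -- The kernel is divided evenly between two square roots, with the reciprocal Schur weights
  -- `|p|/|q|` and `|q|/|p|` inserted. Each factor then reduces to the same Riesz integral.
  set F : R3 × R3 → ENNReal := fun z =>
    f z.1 * ENNReal.ofReal (‖z.1‖ / ‖z.2‖ * √(coulombKernel z.1 z.2)) with hF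
  set G : R3 × R3 → ENNReal := fun z =>
    g z.2 * ENNReal.ofReal (‖z.2‖ / ‖z.1‖ * √(coulombKernel z.2 z.1)) with hG
  have hFm : AEMeasurable F := by
    refine (hf.comp_quasiMeasurePreserving Measure.quasiMeasurePreserving_fst).mul
      (Measurable.aemeasurable ?_)
    fun_prop
  have hGm : AEMeasurable G := by
    refine (hg.comp_quasiMeasurePreserving Measure.quasiMeasurePreserving_snd).mul
      (Measurable.aemeasurable ?_)
    have : Measurable (fun z : R3 × R3 => coulombKernel z.2 z.1) := by
      unfold coulombKernel; fun_prop
    fun_prop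
  have hFG : ∀ᵐ z : R3 × R3, f z.1 * g z.2 * ENNReal.ofReal (coulombKernel z.1 z.2) =
      F z * G z := by
    have h1 : ∀ᵐ z : R3 × R3, z.1 ≠ 0 :=
      Measure.quasiMeasurePreserving_fst.ae ae_ne_zero_R3
    have h2 : ∀ᵐ z : R3 × R3, z.2 ≠ 0 :=
      Measure.quasiMeasurePreserving_snd.ae ae_ne_zero_R3
    filter_upwards [h1, h2] with z hz1 hz2
    have hz1' : 0 < ‖z.1‖ := norm_pos_iff.2 hz1
    have hz2' : 0 < ‖z.2‖ := norm_pos_iff.2 hz2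
    simp only [hF, hG]
    rw [mul_mul_mul_comm, ← ENNReal.ofReal_mul (by positivity), coulombKernel_comm z.2 z.1]
    congr 2
    rw [mul_mul_mul_comm, Real.mul_self_sqrt (coulombKernel_nonneg _ _)]
    field_simp
  rw [lintegral_congr_ae hFG]
  refine (lintegral_sq_mul_rpow_half hFm hGm).trans (le_of_eq ?_)
  have hG2 : ∫⁻ z, G z ^ 2 = ∫⁻ z : R3 × R3,
      (g z.1 * ENNReal.ofReal (‖z.1‖ / ‖z.2‖ * √(coulombKernel z.1 z.2))) ^ 2 := by
    rw [Measure.volume_eq_prod, ← lintegral_prod_swap]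
    rfl
  rw [hG2, lintegral_schur_weight hf, lintegral_schur_weight hg,
    ENNReal.mul_rpow_of_nonneg _ _ (by norm_num), ENNReal.mul_rpow_of_nonneg _ _ (by norm_num),
    mul_mul_mul_comm]
  congr 1
  rw [← ENNReal.rpow_add_of_nonneg _ _ (by norm_num) (by norm_num)]
  norm_num

/-! ### Boundedness and sesquilinearity of the Coulomb form on the weighted space -/

lemma FiniteWeight.weightNorm_ne_top {f : R3 → ℂ} (hf : FiniteWeight f) : weightNorm f ≠ ⊤ :=
  hf.2.ne

lemma lintegral_coulombForm_le {f g : R3 → ℂ} (hf : AEStronglyMeasurable f volume)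
    (hg : AEStronglyMeasurable g volume) :
    ∫⁻ z : R3 × R3, ‖conj (f z.1) * g z.2 * (coulombKernel z.1 z.2 : ℂ)‖ₑ ≤
      ENNReal.ofReal (Real.pi ^ 2) *
        (weightNorm f ^ (1 / 2 : ℝ) * weightNorm g ^ (1 / 2 : ℝ)) := by
  refine le_trans (le_of_eq ?_) (lintegral_mul_coulombKernel_le hf.enorm hg.enorm)
  refine lintegral_congr fun z => ?_
  rw [enorm_mul, enorm_mul, RCLike.enorm_conj]
  congr 1
  rw [← ofReal_norm, Complex.norm_real, Real.norm_of_nonneg (coulombKernel_nonneg _ _)]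

lemma FiniteWeight.integrable_coulombForm {f g : R3 → ℂ} (hf : FiniteWeight f)
    (hg : FiniteWeight g) :
    Integrable (fun z : R3 × R3 => conj (f z.1) * g z.2 * (coulombKernel z.1 z.2 : ℂ)) := by
  refine ⟨?_, ?_⟩
  · refine AEStronglyMeasurable.mul (AEStronglyMeasurable.mul ?_ ?_) ?_
    · exact Complex.continuous_conj.comp_aestronglyMeasurable
        (hf.1.comp_quasiMeasurePreserving Measure.quasiMeasurePreserving_fst)
    · exact hg.1.comp_quasiMeasurePreserving Measure.quasiMeasurePreserving_snd
    · exact (Complex.measurable_ofReal.comp measurable_coulombKernel).aestronglyMeasurable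
  · refine (lintegral_coulombForm_le hf.1 hg.1).trans_lt ?_
    refine ENNReal.mul_lt_top ENNReal.ofReal_lt_top (ENNReal.mul_lt_top ?_ ?_)
    · exact ENNReal.rpow_lt_top_of_nonneg (by norm_num) hf.weightNorm_ne_top
    · exact ENNReal.rpow_lt_top_of_nonneg (by norm_num) hg.weightNorm_ne_top

lemma enorm_coulombForm_le {f g : R3 → ℂ} (hf : AEStronglyMeasurable f volume)
    (hg : AEStronglyMeasurable g volume) :
    ‖coulombForm f g‖ₑ ≤ ENNReal.ofReal (Real.pi ^ 2) *
        (weightNorm f ^ (1 / 2 : ℝ) * weightNorm g ^ (1 / 2 : ℝ)) :=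
  (enorm_integral_le_lintegral_enorm _).trans (lintegral_coulombForm_le hf hg)

lemma FiniteWeight.norm_coulombForm_self_le {f : R3 → ℂ} (hf : FiniteWeight f) :
    ‖coulombForm f f‖ ≤ Real.pi ^ 2 * (weightNorm f).toReal := by
  have h := enorm_coulombForm_le hf.1 hf.1
  rw [← ENNReal.rpow_add_of_nonneg _ _ (by norm_num) (by norm_num),
    show (1 / 2 + 1 / 2 : ℝ) = 1 by norm_num, ENNReal.rpow_one] at h
  have := ENNReal.toReal_mono (ENNReal.mul_ne_top ENNReal.ofReal_ne_top hf.weightNorm_ne_top) h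
  rwa [toReal_enorm, ENNReal.toReal_mul, ENNReal.toReal_ofReal (by positivity)] at this

lemma FiniteWeight.integrable {f : R3 → ℂ} (hf : FiniteWeight f) :
    Integrable (fun ξ => ‖ξ‖ * ‖f ξ‖ ^ 2) := by
  refine ⟨by have := hf.1; fun_prop, ?_⟩
  refine lt_of_eq_of_lt (lintegral_congr fun ξ => ?_) hf.2
  rw [enorm_mul, enorm_norm, enorm_pow, enorm_norm, ofReal_norm]

lemma FiniteWeight.weightNorm_toReal {f : R3 → ℂ} (hf : FiniteWeight f) :
    (weightNorm f).toReal = ∫ ξ, ‖ξ‖ * ‖f ξ‖ ^ 2 := by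
  rw [integral_eq_lintegral_of_nonneg_ae (Eventually.of_forall fun ξ => by positivity)
    hf.integrable.1]
  congr 1
  refine lintegral_congr fun ξ => ?_
  rw [ENNReal.ofReal_mul (by positivity), ENNReal.ofReal_pow (by positivity),
    ofReal_norm (f ξ)]

lemma finiteWeight_of_integrable {f : R3 → ℂ} (hf : AEStronglyMeasurable f volume)
    (h : Integrable (fun ξ => ‖ξ‖ * ‖f ξ‖ ^ 2)) : FiniteWeight f := by
  refine ⟨hf, lt_of_eq_of_lt (lintegral_congr fun ξ => ?_) h.2⟩
  rw [enorm_mul, enorm_norm, enorm_pow, enorm_norm, ofReal_norm]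

lemma FiniteWeight.mono {f g : R3 → ℂ} (hf : FiniteWeight f) (hg : AEStronglyMeasurable g volume)
    (h : ∀ ξ, ‖g ξ‖ ≤ ‖f ξ‖) : FiniteWeight g := by
  refine ⟨hg, lt_of_le_of_lt (lintegral_mono fun ξ => ?_) hf.2⟩
  have : ‖g ξ‖ₑ ≤ ‖f ξ‖ₑ := enorm_le_iff_norm_le.2 (h ξ)
  gcongr

lemma FiniteWeight.indicator {f : R3 → ℂ} (hf : FiniteWeight f) {S : Set R3}
    (hS : MeasurableSet S) : FiniteWeight (S.indicator f) :=
  hf.mono (hf.1.indicator hS) fun ξ => by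
    by_cases h : ξ ∈ S <;> simp [h]

lemma FiniteWeight.add {f g : R3 → ℂ} (hf : FiniteWeight f) (hg : FiniteWeight g) :
    FiniteWeight (fun ξ => f ξ + g ξ) := by
  refine finiteWeight_of_integrable (hf.1.add hg.1) ?_
  refine Integrable.mono' ((hf.integrable.const_mul 2).add (hg.integrable.const_mul 2))
    (by have := hf.1; have := hg.1; fun_prop) (Eventually.of_forall fun ξ => ?_)
  rw [Real.norm_of_nonneg (by positivity)]
  have h1 : ‖f ξ + g ξ‖ ^ 2 ≤ 2 * ‖f ξ‖ ^ 2 + 2 * ‖g ξ‖ ^ 2 := by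
    have := norm_add_le (f ξ) (g ξ)
    nlinarith [norm_nonneg (f ξ + g ξ), sq_nonneg (‖f ξ‖ - ‖g ξ‖), norm_nonneg (f ξ),
      norm_nonneg (g ξ)]
  simp only [Pi.add_apply]
  nlinarith [norm_nonneg ξ]

lemma FiniteWeight.neg {f : R3 → ℂ} (hf : FiniteWeight f) : FiniteWeight (fun ξ => -f ξ) :=
  hf.mono hf.1.neg fun ξ => by simp

lemma FiniteWeight.sub {f g : R3 → ℂ} (hf : FiniteWeight f) (hg : FiniteWeight g) :
    FiniteWeight (fun ξ => f ξ - g ξ) := by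
  simpa only [sub_eq_add_neg] using hf.add hg.neg

lemma coulombForm_sub_right {f g h : R3 → ℂ} (hf : FiniteWeight f) (hg : FiniteWeight g)
    (hh : FiniteWeight h) :
    coulombForm h (fun ξ => f ξ - g ξ) = coulombForm h f - coulombForm h g := by
  unfold coulombForm
  rw [← integral_sub (hh.integrable_coulombForm hf) (hh.integrable_coulombForm hg)]
  congr 1; ext z; ring

lemma coulombForm_add_right {f g h : R3 → ℂ} (hf : FiniteWeight f) (hg : FiniteWeight g)
    (hh : FiniteWeight h) :
    coulombForm h (fun ξ => f ξ + g ξ) = coulombForm h f + coulombForm h g := by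
  unfold coulombForm
  rw [← integral_add (hh.integrable_coulombForm hf) (hh.integrable_coulombForm hg)]
  congr 1; ext z; ring

lemma conj_coulombForm (f g : R3 → ℂ) : conj (coulombForm f g) = coulombForm g f := by
  unfold coulombForm
  rw [← integral_conj, Measure.volume_eq_prod, ← integral_prod_swap]
  congr 1; ext z
  simp only [Prod.fst_swap, Prod.snd_swap, map_mul, Complex.conj_conj, Complex.conj_ofReal]
  rw [coulombKernel_comm z.1 z.2]
  ring

lemma coulombForm_eq_integral_conv {f g : R3 → ℂ} (hf : FiniteWeight f) (hg : FiniteWeight g) :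
    coulombForm f g = ∫ p, conj (f p) * coulombConv g p := by
  unfold coulombForm coulombConv
  rw [Measure.volume_eq_prod, integral_prod _ (hf.integrable_coulombForm hg)]
  congr 1; ext p
  rw [← integral_const_mul]
  congr 1; ext q; ring

lemma FiniteWeight.integrable_conj_mul_conv {f g : R3 → ℂ} (hf : FiniteWeight f)
    (hg : FiniteWeight g) : Integrable (fun p => conj (f p) * coulombConv g p) := by
  refine ((hf.integrable_coulombForm hg).integral_prod_left).congr ?_
  refine Eventually.of_forall fun p => ?_
  simp only [coulombConv]
  rw [← integral_const_mul]
  congr 1; ext q; ring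

lemma lintegral_norm_mul_le {f g : R3 → ℂ} (hf : AEStronglyMeasurable f volume)
    (hg : AEStronglyMeasurable g volume) :
    ∫⁻ ξ, ENNReal.ofReal ‖ξ‖ * (‖f ξ‖ₑ * ‖g ξ‖ₑ) ≤
      weightNorm f ^ (1 / 2 : ℝ) * weightNorm g ^ (1 / 2 : ℝ) := by
  have hs : ∀ ξ : R3, ENNReal.ofReal ‖ξ‖ = ENNReal.ofReal (√‖ξ‖) ^ 2 := fun ξ => by
    rw [← ENNReal.ofReal_pow (by positivity), Real.sq_sqrt (norm_nonneg _)]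
  have h := lintegral_sq_mul_rpow_half (μ := (volume : Measure R3))
    (F := fun ξ => ENNReal.ofReal (√‖ξ‖) * ‖f ξ‖ₑ)
    (G := fun ξ => ENNReal.ofReal (√‖ξ‖) * ‖g ξ‖ₑ)
    ((by fun_prop : Measurable fun ξ : R3 => ENNReal.ofReal (√‖ξ‖)).aemeasurable.mul hf.enorm)
    ((by fun_prop : Measurable fun ξ : R3 => ENNReal.ofReal (√‖ξ‖)).aemeasurable.mul hg.enorm)
  simp only [mul_pow, ← hs] at h
  refine le_trans (le_of_eq (lintegral_congr fun ξ => ?_)) h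
  rw [hs]; ring

/-! ### Positivity of the Coulomb form and its expression in position space -/

/-- The function with Fourier transform `exp (-π s |ξ|²)`. -/
def heatKernel (s : ℝ) (x : R3) : ℝ := ((√s)⁻¹) ^ 3 * Real.exp (-(Real.pi * s⁻¹) * ‖x‖ ^ 2)

lemma heatKernel_nonneg (s : ℝ) (x : R3) : 0 ≤ heatKernel s x := by
  unfold heatKernel; positivity

lemma integrable_heatKernel {s : ℝ} (hs : 0 < s) : Integrable (heatKernel s) := by
  refine Integrable.const_mul ?_ _
  by_contra hn
  have h := integral_gaussian_R3 (inv_pos.2 hs)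
  rw [integral_undef hn] at h
  have : 0 < ((√s⁻¹)⁻¹) ^ 3 := by positivity
  linarith

lemma fourier_heatKernel {s : ℝ} (hs : 0 < s) (w : R3) :
    ∫ x : R3, Complex.exp ((-2 * Real.pi * inner ℝ x w : ℝ) * Complex.I) * (heatKernel s x : ℂ) =
      (Real.exp (-(Real.pi * ‖w‖ ^ 2 * s)) : ℂ) := by
  have hb : 0 < ((Real.pi * s⁻¹ : ℝ) : ℂ).re := by
    rw [Complex.ofReal_re]; positivity
  have h := fourier_gaussian_innerProductSpace hb w
  rw [Real.fourier_eq'] at h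
  have h2 : ∀ x : R3, Complex.exp ((-2 * Real.pi * inner ℝ x w : ℝ) * Complex.I) *
      (heatKernel s x : ℂ) = ((((√s)⁻¹) ^ 3 : ℝ) : ℂ) *
      (Complex.exp ((-2 * Real.pi * inner ℝ x w : ℝ) * Complex.I) •
        Complex.exp (-((Real.pi * s⁻¹ : ℝ) : ℂ) * (‖x‖ : ℂ) ^ 2)) := by
    intro x
    unfold heatKernel
    push_cast
    rw [smul_eq_mul]
    ring
  simp_rw [h2]
  rw [integral_const_mul, h]
  have h3 : ((Real.pi : ℂ) / ((Real.pi * s⁻¹ : ℝ) : ℂ)) = ((s : ℝ) : ℂ) := by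
    push_cast
    have h1 : (Real.pi : ℂ) ≠ 0 := by exact_mod_cast Real.pi_pos.ne'
    have h2 : (s : ℂ) ≠ 0 := by exact_mod_cast hs.ne'
    field_simp
  have h4 : (s : ℂ) ^ ((Module.finrank ℝ R3 : ℂ) / 2) = (((√s) ^ 3 : ℝ) : ℂ) := by
    rw [finrank_euclideanSpace_fin, Real.sqrt_eq_rpow, ← Real.rpow_natCast,
      ← Real.rpow_mul hs.le, Complex.ofReal_cpow hs.le]
    norm_num
  rw [h3, h4, ← mul_assoc, ← Complex.ofReal_mul]
  have h5 : ((√s)⁻¹) ^ 3 * (√s) ^ 3 = 1 := by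
    rw [← mul_pow, inv_mul_cancel₀ (Real.sqrt_pos.2 hs).ne', one_pow]
  rw [h5, Complex.ofReal_one, one_mul, Complex.ofReal_exp]
  congr 1
  push_cast
  have h1 : (Real.pi : ℂ) ≠ 0 := by exact_mod_cast Real.pi_pos.ne'
  have h2 : (s : ℂ) ≠ 0 := by exact_mod_cast hs.ne'
  field_simp

/-- Write the Gaussian in `p - q` as the Fourier transform of `heatKernel s`. Its phase factors into
a phase in `p` and one in `q`, so Fubini produces the two inverse transforms. Integrability of `f`
and `h` makes Fubini legitimate. -/
lemma integral_gaussian_pairing {f h : R3 → ℂ} (hf : Integrable f) (hh : Integrable h) {s : ℝ}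
    (hs : 0 < s) :
    ∫ z : R3 × R3, conj (f z.1) * h z.2 * (Real.exp (-(Real.pi * ‖z.1 - z.2‖ ^ 2 * s)) : ℂ) =
      ∫ x : R3, (heatKernel s x : ℂ) * (conj (𝓕⁻ f x) * 𝓕⁻ h x) := by
  set Φ : R3 → R3 × R3 → ℂ := fun x z =>
    Complex.exp ((-2 * Real.pi * inner ℝ x (z.1 - z.2) : ℝ) * Complex.I) *
      ((heatKernel s x : ℂ) * (conj (f z.1) * h z.2)) with hΦ
  have hfh : Integrable (fun z : R3 × R3 => conj (f z.1) * h z.2) := by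
    have hfc : Integrable (fun p => conj (f p)) :=
      (Complex.conjCLE : ℂ →L[ℝ] ℂ).integrable_comp hf
    exact hfc.mul_prod hh
  have hint : Integrable (Function.uncurry Φ) (volume.prod volume) := by
    have h1 : Integrable (fun w : R3 × (R3 × R3) => (heatKernel s w.1 : ℂ) *
        (conj (f w.2.1) * h w.2.2)) := (integrable_heatKernel hs).ofReal.mul_prod hfh
    refine Integrable.bdd_mul (c := 1) h1 ?_ (Eventually.of_forall fun w => ?_)
    · exact Continuous.aestronglyMeasurable (by fun_prop)
    · rw [Complex.norm_exp_ofReal_mul_I]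
  have hL : ∀ z : R3 × R3, ∫ x, Φ x z =
      conj (f z.1) * h z.2 * (Real.exp (-(Real.pi * ‖z.1 - z.2‖ ^ 2 * s)) : ℂ) := by
    intro z
    rw [← fourier_heatKernel hs (z.1 - z.2), ← integral_const_mul]
    congr 1; ext x
    simp only [hΦ]; ring
  have hR : ∀ x : R3, ∫ z, Φ x z = (heatKernel s x : ℂ) * (conj (𝓕⁻ f x) * 𝓕⁻ h x) := by
    intro x
    have : ∀ z, Φ x z = (heatKernel s x : ℂ) *
        (conj (Complex.exp ((2 * Real.pi * inner ℝ z.1 x : ℝ) * Complex.I) * f z.1) *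
          (Complex.exp ((2 * Real.pi * inner ℝ z.2 x : ℝ) * Complex.I) * h z.2)) := by
      intro z
      have e1 : Complex.exp ((-2 * Real.pi * inner ℝ x (z.1 - z.2) : ℝ) * Complex.I) =
          conj (Complex.exp ((2 * Real.pi * inner ℝ z.1 x : ℝ) * Complex.I)) *
          Complex.exp ((2 * Real.pi * inner ℝ z.2 x : ℝ) * Complex.I) := by
        rw [← Complex.exp_conj, ← Complex.exp_add, map_mul, Complex.conj_ofReal, Complex.conj_I,
          inner_sub_right, real_inner_comm z.1, real_inner_comm z.2]
        congr 1
        push_cast; ring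
      simp only [hΦ, e1, map_mul]; ring
    simp_rw [this]
    rw [integral_const_mul, Measure.volume_eq_prod,
      integral_prod_mul (fun p : R3 => conj (Complex.exp ((2 * Real.pi * inner ℝ p x : ℝ) *
        Complex.I) * f p)) (fun q : R3 => Complex.exp ((2 * Real.pi * inner ℝ q x : ℝ) *
        Complex.I) * h q), integral_conj, Real.fourierInv_eq', Real.fourierInv_eq']
    simp only [smul_eq_mul]
  simp_rw [← hL, ← hR]
  exact (integral_integral_swap hint).symm

lemma integral_exp_neg_eq_coulombKernel {p q : R3} (h : p ≠ q) :
    ∫⁻ s in Set.Ioi (0 : ℝ), ENNReal.ofReal (Real.exp (-(Real.pi * ‖p - q‖ ^ 2 * s))) =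
      ENNReal.ofReal (coulombKernel p q) := by
  have : 0 < ‖p - q‖ := norm_pos_iff.2 (sub_ne_zero.2 h)
  rw [lintegral_exp_neg (by positivity)]
  rfl

lemma ae_fst_ne_snd : ∀ᵐ z : R3 × R3, z.1 ≠ z.2 := by
  rw [Measure.volume_eq_prod]
  refine Measure.ae_prod_iff_ae_ae ?_ |>.2 ?_
  · exact (isClosed_eq continuous_fst continuous_snd).measurableSet.compl
  · refine Eventually.of_forall fun p => ?_
    have : ∀ᵐ q : R3, q ≠ p := by simp [ae_iff]
    filter_upwards [this] with q hq using hq.symm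

/-- Integrating the absolute value over the Gaussian parameter recovers the Coulomb kernel, so
Tonelli reduces this to absolute convergence of the Coulomb form. -/
lemma FiniteWeight.integrable_gaussian {f h : R3 → ℂ} (hf : FiniteWeight f)
    (hh : FiniteWeight h) :
    Integrable (fun w : (R3 × R3) × ℝ => conj (f w.1.1) * h w.1.2 *
      (Real.exp (-(Real.pi * ‖w.1.1 - w.1.2‖ ^ 2 * w.2)) : ℂ))
      ((volume : Measure (R3 × R3)).prod (volume.restrict (Set.Ioi (0 : ℝ)))) := by
  have hm : AEStronglyMeasurable (fun z : R3 × R3 => conj (f z.1) * h z.2) volume := by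
    refine AEStronglyMeasurable.mul ?_ ?_
    · exact Complex.continuous_conj.comp_aestronglyMeasurable
        (hf.1.comp_quasiMeasurePreserving Measure.quasiMeasurePreserving_fst)
    · exact hh.1.comp_quasiMeasurePreserving Measure.quasiMeasurePreserving_snd
  have hm2 : AEStronglyMeasurable (fun w : (R3 × R3) × ℝ => conj (f w.1.1) * h w.1.2 *
      (Real.exp (-(Real.pi * ‖w.1.1 - w.1.2‖ ^ 2 * w.2)) : ℂ))
      ((volume : Measure (R3 × R3)).prod (volume.restrict (Set.Ioi (0 : ℝ)))) :=
    (hm.comp_quasiMeasurePreserving Measure.quasiMeasurePreserving_fst).mul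
      (Continuous.aestronglyMeasurable (by fun_prop))
  refine ⟨hm2, ?_⟩
  rw [HasFiniteIntegral, lintegral_prod _ hm2.enorm]
  refine lt_of_eq_of_lt (lintegral_congr_ae ?_) (hf.integrable_coulombForm hh).2
  filter_upwards [ae_fst_ne_snd] with z hz
  have : ∀ s : ℝ, ‖conj (f z.1) * h z.2 *
      (Real.exp (-(Real.pi * ‖z.1 - z.2‖ ^ 2 * s)) : ℂ)‖ₑ = ‖conj (f z.1) * h z.2‖ₑ *
      ENNReal.ofReal (Real.exp (-(Real.pi * ‖z.1 - z.2‖ ^ 2 * s))) := by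
    intro s
    rw [enorm_mul]
    congr 1
    rw [← ofReal_norm, Complex.norm_real, Real.norm_of_nonneg (Real.exp_pos _).le]
  simp_rw [this]
  rw [lintegral_const_mul _ (by fun_prop), integral_exp_neg_eq_coulombKernel hz, enorm_mul
    (conj (f z.1) * h z.2)]
  congr 1
  rw [← ofReal_norm, Complex.norm_real, Real.norm_of_nonneg (coulombKernel_nonneg _ _)]

lemma FiniteWeight.coulombForm_eq_integral_gaussian {f h : R3 → ℂ} (hf : FiniteWeight f)
    (hh : FiniteWeight h) :
    coulombForm f h = ∫ s in Set.Ioi (0 : ℝ), ∫ z : R3 × R3,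
      conj (f z.1) * h z.2 * (Real.exp (-(Real.pi * ‖z.1 - z.2‖ ^ 2 * s)) : ℂ) := by
  rw [← integral_integral_swap (hf.integrable_gaussian hh)]
  refine integral_congr_ae ?_
  filter_upwards [ae_fst_ne_snd] with z hz
  rw [integral_const_mul, integral_complex_ofReal,
    integral_eq_lintegral_of_nonneg_ae (Eventually.of_forall fun s => (Real.exp_pos _).le)
      (by fun_prop), integral_exp_neg_eq_coulombKernel hz,
    ENNReal.toReal_ofReal (coulombKernel_nonneg _ _)]

lemma FiniteWeight.coulombForm_eq_integral_heatKernel {f h : R3 → ℂ} (hf : FiniteWeight f)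
    (hh : FiniteWeight h) (hf1 : Integrable f) (hh1 : Integrable h) :
    coulombForm f h = ∫ s in Set.Ioi (0 : ℝ), ∫ x : R3,
      (heatKernel s x : ℂ) * (conj (𝓕⁻ f x) * 𝓕⁻ h x) := by
  rw [hf.coulombForm_eq_integral_gaussian hh]
  exact setIntegral_congr_fun measurableSet_Ioi fun s hs =>
    integral_gaussian_pairing hf1 hh1 hs

lemma FiniteWeight.integrable_integral_heatKernel {f h : R3 → ℂ} (hf : FiniteWeight f)
    (hh : FiniteWeight h) (hf1 : Integrable f) (hh1 : Integrable h) :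
    IntegrableOn (fun s => ∫ x : R3, (heatKernel s x : ℂ) * (conj (𝓕⁻ f x) * 𝓕⁻ h x))
      (Set.Ioi (0 : ℝ)) := by
  refine ((hf.integrable_gaussian hh).integral_prod_right).congr ?_
  filter_upwards [ae_restrict_mem measurableSet_Ioi] with s hs
  exact integral_gaussian_pairing hf1 hh1 hs

/-- In the heat kernel representation the diagonal integrand is `heatKernel s x * ‖𝓕⁻ f x‖ ^ 2`.
Thus the form is positive because `1/|x|` is a superposition of positive functions. -/
lemma FiniteWeight.re_coulombForm_self_nonneg {f : R3 → ℂ} (hf : FiniteWeight f)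
    (hf1 : Integrable f) : 0 ≤ (coulombForm f f).re := by
  have : ∀ s x, (heatKernel s x : ℂ) * (conj (𝓕⁻ f x) * 𝓕⁻ f x) =
      ((heatKernel s x * ‖𝓕⁻ f x‖ ^ 2 : ℝ) : ℂ) := by
    intro s x
    rw [← Complex.normSq_eq_conj_mul_self, Complex.normSq_eq_norm_sq, Complex.ofReal_mul]
  rw [hf.coulombForm_eq_integral_heatKernel hf hf1 hf1]
  simp_rw [this, integral_complex_ofReal]
  rw [Complex.ofReal_re]
  exact integral_nonneg fun s => integral_nonneg fun x =>
    mul_nonneg (heatKernel_nonneg s x) (by positivity)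

/-- Inverting the parameter, `s ↦ s⁻¹`, turns this into `lintegral_invSqrt_exp` with `c = ‖x‖ ^ 2`.
-/
lemma lintegral_heatKernel {x : R3} (hx : x ≠ 0) :
    ∫⁻ s in Set.Ioi (0 : ℝ), ENNReal.ofReal (heatKernel s x) = ENNReal.ofReal (1 / ‖x‖) := by
  have hr : 0 < ‖x‖ := norm_pos_iff.2 hx
  have h := lintegral_invSqrt_exp (c := ‖x‖ ^ 2) (by positivity)
  have himg : (fun s : ℝ => s⁻¹) '' Set.Ioi 0 = Set.Ioi 0 := by
    ext t
    simp only [Set.mem_image, Set.mem_Ioi]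
    exact ⟨by rintro ⟨y, hy, rfl⟩; positivity, fun ht => ⟨t⁻¹, by positivity, inv_inv t⟩⟩
  have h2 := lintegral_image_eq_lintegral_abs_deriv_mul (s := Set.Ioi (0 : ℝ))
    (f := fun s => s⁻¹) (f' := fun s => -(s ^ 2)⁻¹) measurableSet_Ioi
    (fun y hy => (hasDerivAt_inv (ne_of_gt hy)).hasDerivWithinAt)
    (fun a _ b _ hab => inv_injective hab)
    (fun t => ENNReal.ofReal ((√t)⁻¹ * Real.exp (-(Real.pi * ‖x‖ ^ 2 * t))))
  rw [himg, h, Real.sqrt_sq hr.le] at h2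
  rw [one_div, h2]
  refine setLIntegral_congr_fun measurableSet_Ioi fun s hs => ?_
  have hs' : (0 : ℝ) < s := hs
  have hq : 0 < √s := Real.sqrt_pos.2 hs'
  rw [← ENNReal.ofReal_mul (by positivity), abs_neg, abs_of_pos (by positivity), Real.sqrt_inv,
    inv_inv]
  congr 1
  unfold heatKernel
  rw [show -(Real.pi * s⁻¹) * ‖x‖ ^ 2 = -(Real.pi * ‖x‖ ^ 2 * s⁻¹) by ring, ← mul_assoc]
  congr 1
  rw [show (s ^ 2)⁻¹ = ((√s ^ 2) ^ 2)⁻¹ by rw [Real.sq_sqrt hs'.le]]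
  field_simp

lemma finiteWeight_schwartz (φ : 𝓢(R3, ℂ)) : FiniteWeight φ := by
  refine finiteWeight_of_integrable φ.continuous.aestronglyMeasurable ?_
  have h1 := φ.integrable_pow_mul volume 1
  have h2 : ∃ C, ∀ x, ‖φ x‖ ≤ C := by
    obtain ⟨C, hC⟩ := φ.decay 0 0
    exact ⟨C, fun x => by simpa using hC.2 x⟩
  obtain ⟨C, hC⟩ := h2
  refine (h1.mul_const C).mono' ?_ (Eventually.of_forall fun ξ => ?_)
  · have := φ.continuous
    exact Continuous.aestronglyMeasurable (by fun_prop)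
  · rw [Real.norm_of_nonneg (by positivity), pow_one, sq, ← mul_assoc]
    exact mul_le_mul_of_nonneg_left (hC ξ) (by positivity)

/-- On the diagonal the integrand is nonnegative, so joint integrability follows from integrability
in `s` of the spatial integral, known from momentum space. The general case is dominated through `|φ
χ| ≤ |φ|² + |χ|²`. -/
lemma integrable_heatKernel_schwartz (φ χ : 𝓢(R3, ℂ)) :
    Integrable (fun w : R3 × ℝ => (heatKernel w.2 w.1 : ℂ) * (conj (φ w.1) * χ w.1))
      ((volume : Measure R3).prod (volume.restrict (Set.Ioi (0 : ℝ)))) := by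
  have hmeas : ∀ φ χ : 𝓢(R3, ℂ), Measurable
      (fun w : R3 × ℝ => (heatKernel w.2 w.1 : ℂ) * (conj (φ w.1) * χ w.1)) := by
    intro φ χ
    have h1 : Measurable (fun w : R3 × ℝ => heatKernel w.2 w.1) := by
      unfold heatKernel; fun_prop
    have h2 := φ.continuous
    have h3 := χ.continuous
    have h4 : Continuous (fun w : R3 × ℝ => conj (φ w.1) * χ w.1) := by fun_prop
    exact (Complex.measurable_ofReal.comp h1).mul h4.measurable
  have hself : ∀ φ : 𝓢(R3, ℂ), Integrable
      (fun w : R3 × ℝ => (heatKernel w.2 w.1 : ℂ) * (conj (φ w.1) * φ w.1))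
      ((volume : Measure R3).prod (volume.restrict (Set.Ioi (0 : ℝ)))) := by
    intro φ
    rw [integrable_prod_iff' (hmeas φ φ).aestronglyMeasurable]
    have hsq : ∀ x, conj (φ x) * φ x = ((‖φ x‖ ^ 2 : ℝ) : ℂ) := fun x => by
      rw [← Complex.normSq_eq_conj_mul_self, Complex.normSq_eq_norm_sq]
    constructor
    · filter_upwards [ae_restrict_mem measurableSet_Ioi] with s hs
      obtain ⟨C, hC⟩ := φ.decay 0 0
      refine ((integrable_heatKernel hs).ofReal (𝕜 := ℂ)).mul_bdd (c := C ^ 2) ?_ ?_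
      · have h2 := φ.continuous
        exact Continuous.aestronglyMeasurable (by fun_prop)
      · refine Eventually.of_forall fun x => ?_
        have h3 : ‖φ x‖ ≤ C := by simpa using hC.2 x
        rw [norm_mul, RCLike.norm_conj, ← sq]
        gcongr
    · have h := (finiteWeight_schwartz (𝓕 φ)).integrable_integral_heatKernel
        (finiteWeight_schwartz (𝓕 φ)) (𝓕 φ).integrable (𝓕 φ).integrable
      refine (h.norm).congr (Eventually.of_forall fun s => ?_)
      simp only [← SchwartzMap.fourierInv_coe, FourierTransform.fourierInv_fourier_eq, hsq,
        ← Complex.ofReal_mul, integral_complex_ofReal, Complex.norm_real]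
      rw [Real.norm_of_nonneg]
      · refine integral_congr_ae (Eventually.of_forall fun x => ?_)
        simp only
        rw [Real.norm_of_nonneg (mul_nonneg (heatKernel_nonneg _ _) (by positivity))]
      · exact integral_nonneg fun x => mul_nonneg (heatKernel_nonneg _ _) (by positivity)
  refine ((hself φ).norm.add (hself χ).norm).mono' (hmeas φ χ).aestronglyMeasurable
    (Eventually.of_forall fun w => ?_)
  simp only [Pi.add_apply, norm_mul, RCLike.norm_conj]
  have := norm_nonneg (heatKernel w.2 w.1 : ℂ)
  have h1 : ‖φ w.1‖ * ‖χ w.1‖ ≤ ‖φ w.1‖ * ‖φ w.1‖ + ‖χ w.1‖ * ‖χ w.1‖ := by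
    nlinarith [sq_nonneg (‖φ w.1‖ - ‖χ w.1‖), sq_nonneg (‖φ w.1‖), sq_nonneg (‖χ w.1‖)]
  rw [← mul_add]
  exact mul_le_mul_of_nonneg_left h1 this

/-- The Coulomb form on Schwartz functions in position and in momentum space. -/
lemma integral_coulomb_eq_coulombForm (φ χ : 𝓢(R3, ℂ)) :
    ∫ x : R3, ((1 / ‖x‖ : ℝ) : ℂ) * (conj (φ x) * χ x) =
      coulombForm (𝓕 φ : 𝓢(R3, ℂ)) (𝓕 χ : 𝓢(R3, ℂ)) := by
  rw [(finiteWeight_schwartz (𝓕 φ)).coulombForm_eq_integral_heatKernel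
    (finiteWeight_schwartz (𝓕 χ)) (𝓕 φ).integrable (𝓕 χ).integrable]
  simp only [← SchwartzMap.fourierInv_coe, FourierTransform.fourierInv_fourier_eq]
  rw [← integral_integral_swap (integrable_heatKernel_schwartz φ χ)]
  refine integral_congr_ae ?_
  filter_upwards [ae_ne_zero_R3] with x hx
  rw [integral_mul_const, integral_complex_ofReal, integral_eq_lintegral_of_nonneg_ae
    (Eventually.of_forall fun s => heatKernel_nonneg s x) (by
      have : Measurable (fun s => heatKernel s x) := by unfold heatKernel; fun_prop
      exact this.aestronglyMeasurable), lintegral_heatKernel hx,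
    ENNReal.toReal_ofReal (by positivity)]

lemma hydrogenForm_eq (γ : ℝ) (φ χ : testFunctions) :
    hydrogenForm γ φ χ =
      (∫ ξ : R3, (kinetic (absMomentum ξ) : ℂ) *
        (conj (𝓕 (φ : 𝓢(R3, ℂ)) ξ) * 𝓕 (χ : 𝓢(R3, ℂ)) ξ)) -
      γ * coulombForm (𝓕 (φ : 𝓢(R3, ℂ)) : 𝓢(R3, ℂ)) (𝓕 (χ : 𝓢(R3, ℂ)) : 𝓢(R3, ℂ)) := by
  unfold hydrogenForm
  rw [← integral_coulomb_eq_coulombForm, ← integral_const_mul]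
  congr 2
  ext x
  push_cast
  ring

/-! ### The form domain in momentum space -/

/-- The sesquilinear form of the kinetic energy in momentum space. -/
def kineticForm (f g : R3 → ℂ) : ℂ :=
  ∫ ξ : R3, (kinetic (absMomentum ξ) : ℂ) * (conj (f ξ) * g ξ)

lemma absMomentum_nonneg (ξ : R3) : 0 ≤ absMomentum ξ := by
  unfold absMomentum; positivity

lemma kinetic_nonneg (s : ℝ) : 0 ≤ kinetic s := by
  unfold kinetic
  have : 1 ≤ √(s ^ 2 + 1) := Real.one_le_sqrt.2 (by nlinarith [sq_nonneg s])
  linarith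

lemma kinetic_le {s : ℝ} (hs : 0 ≤ s) : kinetic s ≤ s := by
  unfold kinetic
  have : √(s ^ 2 + 1) ≤ s + 1 := Real.sqrt_le_iff.2 ⟨by linarith, by nlinarith⟩
  linarith

lemma sub_one_le_kinetic (s : ℝ) : s - 1 ≤ kinetic s := by
  unfold kinetic
  have : s ≤ √(s ^ 2 + 1) := Real.le_sqrt_of_sq_le (by linarith)
  linarith

lemma measurable_absMomentum : Measurable absMomentum := by
  unfold absMomentum; fun_prop

lemma measurable_kinetic : Measurable kinetic := by
  unfold kinetic; fun_prop

lemma measurable_kinetic_absMomentum : Measurable (fun ξ => kinetic (absMomentum ξ)) :=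
  measurable_kinetic.comp measurable_absMomentum

lemma lintegral_kineticForm_le {f g : R3 → ℂ} (hf : AEStronglyMeasurable f volume)
    (hg : AEStronglyMeasurable g volume) :
    ∫⁻ ξ, ‖(kinetic (absMomentum ξ) : ℂ) * (conj (f ξ) * g ξ)‖ₑ ≤
      ENNReal.ofReal (2 * Real.pi) *
        (weightNorm f ^ (1 / 2 : ℝ) * weightNorm g ^ (1 / 2 : ℝ)) := by
  refine le_trans ?_ (mul_le_mul_right (lintegral_norm_mul_le hf hg) _)
  rw [← lintegral_const_mul' _ _ ENNReal.ofReal_ne_top]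
  refine lintegral_mono fun ξ => ?_
  rw [enorm_mul, enorm_mul, RCLike.enorm_conj, ← mul_assoc (ENNReal.ofReal _),
    ← ENNReal.ofReal_mul (by positivity)]
  refine mul_le_mul_left ?_ _
  rw [← ofReal_norm, Complex.norm_real, Real.norm_of_nonneg (kinetic_nonneg _)]
  exact ENNReal.ofReal_le_ofReal (kinetic_le (absMomentum_nonneg ξ))

lemma FiniteWeight.integrable_kineticForm {f g : R3 → ℂ} (hf : FiniteWeight f)
    (hg : FiniteWeight g) :
    Integrable (fun ξ => (kinetic (absMomentum ξ) : ℂ) * (conj (f ξ) * g ξ)) := by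
  refine ⟨?_, ?_⟩
  · refine AEStronglyMeasurable.mul ?_ (AEStronglyMeasurable.mul ?_ hg.1)
    · exact (Complex.measurable_ofReal.comp measurable_kinetic_absMomentum).aestronglyMeasurable
    · exact Complex.continuous_conj.comp_aestronglyMeasurable hf.1
  · refine (lintegral_kineticForm_le hf.1 hg.1).trans_lt ?_
    refine ENNReal.mul_lt_top ENNReal.ofReal_lt_top (ENNReal.mul_lt_top ?_ ?_)
    · exact ENNReal.rpow_lt_top_of_nonneg (by norm_num) hf.weightNorm_ne_top
    · exact ENNReal.rpow_lt_top_of_nonneg (by norm_num) hg.weightNorm_ne_top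

lemma enorm_kineticForm_le {f g : R3 → ℂ} (hf : AEStronglyMeasurable f volume)
    (hg : AEStronglyMeasurable g volume) :
    ‖kineticForm f g‖ₑ ≤ ENNReal.ofReal (2 * Real.pi) *
        (weightNorm f ^ (1 / 2 : ℝ) * weightNorm g ^ (1 / 2 : ℝ)) :=
  (enorm_integral_le_lintegral_enorm _).trans (lintegral_kineticForm_le hf hg)

lemma kineticForm_sub_right {f g h : R3 → ℂ} (hf : FiniteWeight f) (hg : FiniteWeight g)
    (hh : FiniteWeight h) :
    kineticForm h (fun ξ => f ξ - g ξ) = kineticForm h f - kineticForm h g := by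
  unfold kineticForm
  rw [← integral_sub (hh.integrable_kineticForm hf) (hh.integrable_kineticForm hg)]
  congr 1; ext z; ring

lemma conj_mul_self_eq (z : ℂ) : conj z * z = ((‖z‖ ^ 2 : ℝ) : ℂ) := by
  rw [← Complex.normSq_eq_conj_mul_self, Complex.normSq_eq_norm_sq]

lemma kineticForm_self (f : R3 → ℂ) :
    kineticForm f f = ((∫ ξ, kinetic (absMomentum ξ) * ‖f ξ‖ ^ 2 : ℝ) : ℂ) := by
  unfold kineticForm
  rw [← integral_complex_ofReal]
  congr 1; ext ξ
  rw [conj_mul_self_eq, Complex.ofReal_mul]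

lemma FiniteWeight.integrable_kinetic {f : R3 → ℂ} (hf : FiniteWeight f) :
    Integrable (fun ξ => kinetic (absMomentum ξ) * ‖f ξ‖ ^ 2) := by
  refine (hf.integrable_kineticForm hf).re.congr (Eventually.of_forall fun ξ => ?_)
  simp only [conj_mul_self_eq, ← Complex.ofReal_mul]
  exact Complex.ofReal_re _

/-- A bounded additive functional is continuous for the weighted seminorm. It serves both the
kinetic and the Coulomb form with one argument fixed. -/
lemma tendsto_of_enorm_le {B : (R3 → ℂ) → ℂ} {C : ENNReal} (hC : C ≠ ⊤) {g : ℕ → R3 → ℂ}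
    {f : R3 → ℂ} (hg : ∀ n, FiniteWeight (g n)) (hf : FiniteWeight f)
    (hlim : Tendsto (fun n => weightNorm (fun ξ => g n ξ - f ξ)) atTop (𝓝 0))
    (hsub : ∀ n, B (fun ξ => g n ξ - f ξ) = B (g n) - B f)
    (hbd : ∀ h, FiniteWeight h → ‖B h‖ₑ ≤ C * weightNorm h ^ (1 / 2 : ℝ)) :
    Tendsto (fun n => B (g n)) atTop (𝓝 (B f)) := by
  rw [tendsto_iff_edist_tendsto_0]
  have h0 : Tendsto (fun n => C * weightNorm (fun ξ => g n ξ - f ξ) ^ (1 / 2 : ℝ)) atTop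
      (𝓝 0) := by
    have h1 := (ENNReal.continuous_rpow_const (y := 1 / 2)).tendsto 0 |>.comp hlim
    have h2 := ENNReal.Tendsto.const_mul h1 (Or.inr hC)
    rw [ENNReal.zero_rpow_of_pos (by norm_num), mul_zero] at h2
    exact h2
  refine tendsto_of_tendsto_of_tendsto_of_le_of_le tendsto_const_nhds h0
    (fun n => zero_le) fun n => ?_
  change edist (B (g n)) (B f) ≤ _
  rw [edist_eq_enorm_sub, ← hsub]
  exact hbd _ ((hg n).sub hf)

lemma tendsto_coulombForm {g : ℕ → R3 → ℂ} {f h : R3 → ℂ} (hg : ∀ n, FiniteWeight (g n))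
    (hf : FiniteWeight f) (hh : FiniteWeight h)
    (hlim : Tendsto (fun n => weightNorm (fun ξ => g n ξ - f ξ)) atTop (𝓝 0)) :
    Tendsto (fun n => coulombForm h (g n)) atTop (𝓝 (coulombForm h f)) := by
  refine tendsto_of_enorm_le (C := ENNReal.ofReal (Real.pi ^ 2) * weightNorm h ^ (1 / 2 : ℝ))
    (ENNReal.mul_ne_top ENNReal.ofReal_ne_top
      (ENNReal.rpow_ne_top_of_nonneg (by norm_num) hh.weightNorm_ne_top)) hg hf hlim
    (fun n => coulombForm_sub_right (hg n) hf hh) fun k hk => ?_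
  rw [mul_assoc]
  exact enorm_coulombForm_le hh.1 hk.1

lemma tendsto_kineticForm {g : ℕ → R3 → ℂ} {f h : R3 → ℂ} (hg : ∀ n, FiniteWeight (g n))
    (hf : FiniteWeight f) (hh : FiniteWeight h)
    (hlim : Tendsto (fun n => weightNorm (fun ξ => g n ξ - f ξ)) atTop (𝓝 0)) :
    Tendsto (fun n => kineticForm h (g n)) atTop (𝓝 (kineticForm h f)) := by
  refine tendsto_of_enorm_le (C := ENNReal.ofReal (2 * Real.pi) * weightNorm h ^ (1 / 2 : ℝ))
    (ENNReal.mul_ne_top ENNReal.ofReal_ne_top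
      (ENNReal.rpow_ne_top_of_nonneg (by norm_num) hh.weightNorm_ne_top)) hg hf hlim
    (fun n => kineticForm_sub_right (hg n) hf hh) fun k hk => ?_
  rw [mul_assoc]
  exact enorm_kineticForm_le hh.1 hk.1

/-- The Fourier transform of a test function. -/
def testFourier (φ : testFunctions) : 𝓢(R3, ℂ) := 𝓕 (φ : 𝓢(R3, ℂ))

lemma testFourier_sub (φ χ : testFunctions) :
    testFourier (φ - χ) = testFourier φ - testFourier χ :=
  (FourierTransform.fourierCLM ℂ 𝓢(R3, ℂ)).map_sub (φ : 𝓢(R3, ℂ)) (χ : 𝓢(R3, ℂ))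

lemma testToL2_sub (φ χ : testFunctions) : testToL2 (φ - χ) = testToL2 φ - testToL2 χ :=
  (SchwartzMap.toLpCLM ℂ ℂ 2 (volume : Measure R3)).map_sub (φ : 𝓢(R3, ℂ)) (χ : 𝓢(R3, ℂ))

lemma fourier_testToL2 (φ : testFunctions) : 𝓕 (testToL2 φ) = (testFourier φ).toLp 2 :=
  SchwartzMap.toLp_fourier_eq _

lemma hydrogenForm_eq_kineticForm (γ : ℝ) (φ χ : testFunctions) :
    hydrogenForm γ φ χ = kineticForm (testFourier φ) (testFourier χ) -
      γ * coulombForm (testFourier φ) (testFourier χ) :=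
  hydrogenForm_eq γ φ χ

lemma norm_sq_testToL2 (φ : testFunctions) :
    ‖testToL2 φ‖ ^ 2 = ∫ ξ, ‖testFourier φ ξ‖ ^ 2 := by
  have h1 : ‖testToL2 φ‖ = ‖(testFourier φ).toLp 2 volume‖ :=
    (SchwartzMap.norm_fourier_toL2_eq (φ : 𝓢(R3, ℂ))).symm
  have h2 := SchwartzMap.norm_toLp' (f := testFourier φ) (p := 2) (μ := volume) (by norm_num)
    (by norm_num)
  simp only [ENNReal.toReal_ofNat, Real.rpow_ofNat] at h2
  rw [h1, h2, ← one_div, ← Real.sqrt_eq_rpow,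
    Real.sq_sqrt (integral_nonneg fun x => by positivity)]

/-- Coercivity of the hydrogen form below the critical coupling constant. -/
lemma weightNorm_le_hydrogenForm {γ : ℝ} (hγ0 : 0 < γ) (φ : testFunctions) :
    (2 * Real.pi - γ * Real.pi ^ 2) * (weightNorm (testFourier φ)).toReal ≤
      (hydrogenForm γ φ φ).re + ‖testToL2 φ‖ ^ 2 := by
  have hw := finiteWeight_schwartz (testFourier φ)
  have hB := hw.norm_coulombForm_self_le
  have hB' := (Complex.re_le_norm (coulombForm (testFourier φ) (testFourier φ))).trans hB
  have hI : Integrable (fun ξ => ‖testFourier φ ξ‖ ^ 2) := by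
    simpa using ((testFourier φ).memLp 2 volume).integrable_norm_pow (by norm_num)
  -- Since `|p| - 1` is at most the kinetic symbol, adding the squared norm controls all of `|p|`.
  -- Subtracting Kato's bound then leaves the factor `2π - γπ²`.
  have hT : 2 * Real.pi * (weightNorm (testFourier φ)).toReal ≤
      (∫ ξ, kinetic (absMomentum ξ) * ‖testFourier φ ξ‖ ^ 2) + ‖testToL2 φ‖ ^ 2 := by
    rw [hw.weightNorm_toReal, norm_sq_testToL2, ← integral_const_mul,
      ← integral_add hw.integrable_kinetic hI]
    refine integral_mono (hw.integrable.const_mul _) (hw.integrable_kinetic.add hI) fun ξ => ?_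
    have := sub_one_le_kinetic (absMomentum ξ)
    have h2 : absMomentum ξ = 2 * Real.pi * ‖ξ‖ := rfl
    simp only
    nlinarith [sq_nonneg ‖testFourier φ ξ‖]
  rw [hydrogenForm_eq_kineticForm, kineticForm_self, Complex.sub_re, Complex.ofReal_re,
    Complex.re_ofReal_mul]
  nlinarith

lemma tendsto_weightNorm_of_formConverges {γ : ℝ} (hγ0 : 0 < γ) (hγ1 : γ < 2 / Real.pi)
    {u : ℕ → testFunctions} {ψ : L2R3} (hu : FormConverges testToL2 (hydrogenForm γ) u ψ) :
    Tendsto (fun k : ℕ × ℕ => weightNorm (fun ξ => testFourier (u k.1) ξ - testFourier (u k.2) ξ))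
      atTop (𝓝 0) := by
  have hpi := Real.pi_pos
  have hc : 0 < 2 * Real.pi - γ * Real.pi ^ 2 := by
    rw [lt_div_iff₀ hpi] at hγ1
    nlinarith
  have hre : Tendsto (fun k : ℕ × ℕ => (hydrogenForm γ (u k.1 - u k.2) (u k.1 - u k.2)).re)
      atTop (𝓝 0) := by
    have := (Complex.continuous_re.tendsto 0).comp hu.2
    rw [Complex.zero_re] at this
    exact this
  have hn : Tendsto (fun k : ℕ × ℕ => ‖testToL2 (u k.1 - u k.2)‖ ^ 2) atTop (𝓝 0) := by
    have h1 : Tendsto (fun k : ℕ × ℕ => testToL2 (u k.1)) atTop (𝓝 ψ) := by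
      rw [← prod_atTop_atTop_eq]; exact hu.1.comp tendsto_fst
    have h2 : Tendsto (fun k : ℕ × ℕ => testToL2 (u k.2)) atTop (𝓝 ψ) := by
      rw [← prod_atTop_atTop_eq]; exact hu.1.comp tendsto_snd
    have h3 := ((h1.sub h2).norm).pow 2
    simp only [sub_self, norm_zero, ne_eq, OfNat.ofNat_ne_zero, not_false_eq_true, zero_pow] at h3
    simpa only [testToL2_sub] using h3
  have hsum := (hre.add hn).const_mul (2 * Real.pi - γ * Real.pi ^ 2)⁻¹
  rw [add_zero, mul_zero] at hsum
  have hsum' := ENNReal.tendsto_ofReal hsum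
  rw [ENNReal.ofReal_zero] at hsum'
  refine tendsto_of_tendsto_of_tendsto_of_le_of_le tendsto_const_nhds hsum'
    (fun k => zero_le) fun k => ?_
  have heq : (fun ξ => testFourier (u k.1) ξ - testFourier (u k.2) ξ) =
      ⇑(testFourier (u k.1 - u k.2)) := by
    rw [testFourier_sub]; rfl
  simp only [heq]
  have hw := finiteWeight_schwartz (testFourier (u k.1 - u k.2))
  rw [← ENNReal.ofReal_toReal hw.weightNorm_ne_top]
  refine ENNReal.ofReal_le_ofReal ?_
  rw [inv_mul_eq_div, le_div_iff₀ hc, mul_comm]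
  exact weightNorm_le_hydrogenForm hγ0 _

/-- Coercivity gives a Cauchy sequence in the weighted seminorm. Its limit is identified without a
completeness theorem: `L²` convergence yields an a.e. convergent subsequence, and Fatou's lemma
passes the Cauchy estimate to the limit. -/
lemma tendsto_weightNorm_sub_fourier {γ : ℝ} (hγ0 : 0 < γ) (hγ1 : γ < 2 / Real.pi)
    {u : ℕ → testFunctions} {ψ : L2R3} (hu : FormConverges testToL2 (hydrogenForm γ) u ψ) :
    Tendsto (fun n => weightNorm (fun ξ => testFourier (u n) ξ - (𝓕 ψ : L2R3) ξ))
      atTop (𝓝 0) := by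
  have hC := tendsto_weightNorm_of_formConverges hγ0 hγ1 hu
  have hF : Tendsto (fun n => 𝓕 (testToL2 (u n))) atTop (𝓝 (𝓕 ψ)) :=
    ((ContinuousFourier.continuous_fourier (E := L2R3)).tendsto ψ).comp hu.1
  obtain ⟨ns, hns, hae⟩ := (tendstoInMeasure_of_tendsto_Lp hF).exists_seq_tendsto_ae
  have hcoe : ∀ᵐ ξ : R3, ∀ n, (𝓕 (testToL2 (u n)) : L2R3) ξ = testFourier (u n) ξ := by
    refine ae_all_iff.2 fun n => ?_
    rw [fourier_testToL2]
    exact SchwartzMap.coeFn_toLp _ 2 volume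
  rw [ENNReal.tendsto_atTop_zero] at hC ⊢
  intro ε hε
  obtain ⟨⟨N, M⟩, hNM⟩ := hC ε hε
  refine ⟨max N M, fun n hn => ?_⟩
  have hfatou := lintegral_liminf_le' (μ := (volume : Measure R3)) (u := atTop)
    (f := fun k ξ => ENNReal.ofReal ‖ξ‖ *
      ‖testFourier (u n) ξ - testFourier (u (ns k)) ξ‖ₑ ^ 2) (fun k => by
        have h1 := (testFourier (u n)).continuous
        have h2 := (testFourier (u (ns k))).continuous
        exact Measurable.aemeasurable (by fun_prop))
  have hle : liminf (fun k => ∫⁻ ξ : R3, ENNReal.ofReal ‖ξ‖ *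
      ‖testFourier (u n) ξ - testFourier (u (ns k)) ξ‖ₑ ^ 2) atTop ≤ ε := by
    refine liminf_le_of_frequently_le' (Eventually.frequently ?_)
    filter_upwards [hns.tendsto_atTop.eventually_ge_atTop (max N M)] with k hk
    exact hNM (n, ns k) ⟨(le_max_left _ _).trans hn, (le_max_right _ _).trans hk⟩
  refine le_trans (le_of_eq ?_) (hfatou.trans hle)
  refine lintegral_congr_ae ?_
  filter_upwards [hae, hcoe] with ξ hξ hξc
  simp only [hξc] at hξ
  symm
  refine Tendsto.liminf_eq ?_
  refine ENNReal.Tendsto.const_mul ?_ (Or.inr ENNReal.ofReal_ne_top)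
  exact ((ENNReal.continuous_pow 2).tendsto _).comp
    ((continuous_enorm.tendsto _).comp (hξ.const_sub _))

lemma finiteWeight_fourier_of_formConverges {γ : ℝ} (hγ0 : 0 < γ) (hγ1 : γ < 2 / Real.pi)
    {u : ℕ → testFunctions} {ψ : L2R3} (hu : FormConverges testToL2 (hydrogenForm γ) u ψ) :
    FiniteWeight (𝓕 ψ : L2R3) := by
  have h := tendsto_weightNorm_sub_fourier hγ0 hγ1 hu
  obtain ⟨n, hn⟩ := (h.eventually (gt_mem_nhds (zero_lt_one' ENNReal))).exists
  have hm := (Lp.memLp (𝓕 ψ : L2R3)).1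
  have h1 : FiniteWeight (fun ξ => testFourier (u n) ξ - (𝓕 ψ : L2R3) ξ) :=
    ⟨(testFourier (u n)).continuous.aestronglyMeasurable.sub hm, hn.trans ENNReal.one_lt_top⟩
  have h2 := (finiteWeight_schwartz (testFourier (u n))).sub h1
  simpa using h2

/-- The weak eigenvalue equation in momentum space. -/
lemma kineticForm_sub_coulombForm_of_graph {γ : ℝ} (hγ0 : 0 < γ) (hγ1 : γ < 2 / Real.pi)
    {ψ : L2R3} {E : ℂ} (h : FriedrichsGraph testToL2 (hydrogenForm γ) ψ (E • ψ)) :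
    FiniteWeight (𝓕 ψ : L2R3) ∧ ∀ φ : testFunctions,
      kineticForm (testFourier φ) (𝓕 ψ : L2R3) -
        γ * coulombForm (testFourier φ) (𝓕 ψ : L2R3) =
      E * ∫ ξ, conj (testFourier φ ξ) * (𝓕 ψ : L2R3) ξ := by
  obtain ⟨u, hu, hlim⟩ := h
  have hf := finiteWeight_fourier_of_formConverges hγ0 hγ1 hu
  refine ⟨hf, fun φ => ?_⟩
  have hw := tendsto_weightNorm_sub_fourier hγ0 hγ1 hu
  have hφ := finiteWeight_schwartz (testFourier φ)
  have hun := fun n => finiteWeight_schwartz (testFourier (u n))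
  have h1 := (tendsto_kineticForm hun hf hφ hw).sub
    ((tendsto_coulombForm hun hf hφ hw).const_mul (γ : ℂ))
  have h2 := hlim φ
  simp only [hydrogenForm_eq_kineticForm] at h2
  rw [tendsto_nhds_unique h1 h2, inner_smul_right, ← Lp.inner_fourier_eq, fourier_testToL2,
    L2.inner_def]
  congr 1
  refine integral_congr_ae ?_
  filter_upwards [SchwartzMap.coeFn_toLp (testFourier φ) 2 volume] with ξ hξ
  rw [hξ, RCLike.inner_apply']

/-! ### The pointwise eigenvalue equation in momentum space -/

/-- By duality: each smooth compactly supported function is the Fourier transform of a Schwartz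
function, and the transform can be moved onto `h`. -/
lemma ae_eq_zero_of_fourier_eq_zero {h : R3 → ℂ} (hh : Integrable h) (h0 : ∀ a, 𝓕 h a = 0) :
    ∀ᵐ ξ, h ξ = 0 := by
  refine ae_eq_zero_of_integral_contDiff_smul_eq_zero hh.locallyIntegrable fun g hg hgc => ?_
  have hgc' : HasCompactSupport (fun x => (g x : ℂ)) := hgc.comp_left Complex.ofReal_zero
  set G : 𝓢(R3, ℂ) := hgc'.toSchwartzMap (Complex.ofRealCLM.contDiff.comp hg) with hG
  have hflip : ∫ ξ, 𝓕 ((𝓕⁻ G : 𝓢(R3, ℂ)) : R3 → ℂ) ξ • h ξ =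
      ∫ x, (𝓕⁻ G : 𝓢(R3, ℂ)) x • 𝓕 h x := by
    have := VectorFourier.integral_fourierIntegral_smul_eq_flip (L := innerₗ R3)
      Real.continuous_fourierChar continuous_inner ((𝓕⁻ G : 𝓢(R3, ℂ)).integrable (μ := volume)) hh
    rw [flip_innerₗ] at this
    exact this
  rw [← SchwartzMap.fourier_coe, FourierTransform.fourier_fourierInv_eq] at hflip
  simp only [h0, smul_zero, integral_zero] at hflip
  rw [← hflip]
  rfl

/-- Translation of a test function. -/
def testTranslate (a : R3) (φ : testFunctions) : testFunctions :=
  have hc : HasCompactSupport (fun x => (φ : 𝓢(R3, ℂ)) (x + a)) :=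
    φ.2.comp_homeomorph (Homeomorph.addRight a)
  ⟨hc.toSchwartzMap (((φ : 𝓢(R3, ℂ)).smooth ⊤).comp (contDiff_id.add contDiff_const)), hc⟩

lemma testFourier_testTranslate (a : R3) (φ : testFunctions) (ξ : R3) :
    testFourier (testTranslate a φ) ξ =
      Complex.exp ((2 * Real.pi * inner ℝ a ξ : ℝ) * Complex.I) * testFourier φ ξ := by
  unfold testFourier
  rw [SchwartzMap.fourier_coe, SchwartzMap.fourier_coe, Real.fourier_eq', Real.fourier_eq',
    ← integral_const_mul]
  rw [← integral_add_right_eq_self (fun x => Complex.exp ((2 * Real.pi * inner ℝ a ξ : ℝ) *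
    Complex.I) * Complex.exp ((-2 * Real.pi * inner ℝ x ξ : ℝ) * Complex.I) •
    (φ : 𝓢(R3, ℂ)) x) a]
  congr 1; ext x
  change _ • (φ : 𝓢(R3, ℂ)) (x + a) = _
  rw [smul_eq_mul, smul_eq_mul, ← mul_assoc, ← Complex.exp_add]
  congr 2
  rw [inner_add_left]
  push_cast; ring

/-- A nonnegative bump concentrated near the origin works: on its support the phase stays so small
that the cosine is nonnegative, and the real part of the transform is positive. -/
lemma exists_testFourier_ne_zero (R : ℝ) :
    ∃ φ : testFunctions, ∀ ξ : R3, ‖ξ‖ ≤ R → testFourier φ ξ ≠ 0 := by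
  -- This radius keeps `|2π x·ξ| ≤ 1 < π/2` whenever `‖x‖ < r` and `‖ξ‖ ≤ R`; the `+ 1` avoids a
  -- zero denominator.
  set r : ℝ := (2 * Real.pi * (|R| + 1))⁻¹ with hr
  have hpi := Real.pi_pos
  have hr0 : 0 < r := by positivity
  let b : ContDiffBump (0 : R3) := ⟨r / 2, r, by positivity, by linarith⟩
  have hc : HasCompactSupport (fun x => (b x : ℂ)) :=
    b.hasCompactSupport.comp_left Complex.ofReal_zero
  let φ : testFunctions := ⟨hc.toSchwartzMap (Complex.ofRealCLM.contDiff.comp b.contDiff), hc⟩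
  refine ⟨φ, fun ξ hξ h0 => ?_⟩
  have hpos : 0 < ∫ x : R3, Real.cos (2 * Real.pi * inner ℝ x ξ) * b x := by
    refine Continuous.integral_pos_of_hasCompactSupport_nonneg_nonzero (x := 0) ?_ ?_ ?_ ?_
    · have := b.continuous
      fun_prop
    · exact b.hasCompactSupport.mul_left
    · intro x
      by_cases hx : ‖x‖ < r
      · refine mul_nonneg (Real.cos_nonneg_of_mem_Icc ?_) b.nonneg
        have h1 : |2 * Real.pi * inner ℝ x ξ| ≤ 1 := by
          rw [abs_mul, abs_of_pos (by positivity)]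
          have h2 := abs_real_inner_le_norm x ξ
          have h3 : ‖x‖ * ‖ξ‖ ≤ r * (|R| + 1) := by
            have := le_abs_self R
            gcongr
            linarith
          calc 2 * Real.pi * |inner ℝ x ξ| ≤ 2 * Real.pi * (r * (|R| + 1)) := by
                have := h2.trans h3
                gcongr
            _ = 1 := by rw [hr]; field_simp
        have h4 := abs_le.1 h1
        have h5 := Real.pi_gt_three
        constructor <;> linarith [h4.1, h4.2]
      · have : b x = 0 := b.zero_of_le_dist (by simpa using hx)
        simp [this]
    · have : b 0 = 1 := b.one_of_mem_closedBall (by simp [b]; positivity)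
      simp [this]
  have hre : (testFourier φ ξ).re = ∫ x : R3, Real.cos (2 * Real.pi * inner ℝ x ξ) * b x := by
    unfold testFourier
    rw [SchwartzMap.fourier_coe, Real.fourier_eq']
    have hint : Integrable (fun x : R3 => Complex.exp ((-2 * Real.pi * inner ℝ x ξ : ℝ) *
        Complex.I) • (φ : 𝓢(R3, ℂ)) x) := by
      refine Integrable.bdd_mul (c := 1) (φ : 𝓢(R3, ℂ)).integrable ?_
        (Eventually.of_forall fun w => ?_)
      · exact Continuous.aestronglyMeasurable (by fun_prop)
      · rw [Complex.norm_exp_ofReal_mul_I]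
    have := integral_re hint
    simp only [RCLike.re_eq_complex_re] at this
    rw [← this]
    congr 1; ext x
    change (Complex.exp _ * (b x : ℂ)).re = _
    rw [Complex.re_mul_ofReal, Complex.exp_ofReal_mul_I_re,
      show -2 * Real.pi * inner ℝ x ξ = -(2 * Real.pi * inner ℝ x ξ) by ring, Real.cos_neg]
  rw [h0, Complex.zero_re] at hre
  linarith

/-- `G` itself need not be integrable. Translating `φ` multiplies its transform by a phase, so the
hypothesis says that the integrable function `conj φ̂ · G` has vanishing Fourier transform. Choosing
`φ̂` without zeros on larger and larger balls removes the factor. -/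
lemma ae_eq_zero_of_forall_testFourier {G : R3 → ℂ}
    (hint : ∀ φ : testFunctions, Integrable (fun ξ => conj (testFourier φ ξ) * G ξ))
    (h0 : ∀ φ : testFunctions, ∫ ξ, conj (testFourier φ ξ) * G ξ = 0) :
    ∀ᵐ ξ, G ξ = 0 := by
  have h1 : ∀ φ : testFunctions, ∀ᵐ ξ, conj (testFourier φ ξ) * G ξ = 0 := by
    refine fun φ => ae_eq_zero_of_fourier_eq_zero (hint φ) fun a => ?_
    rw [Real.fourier_eq', ← h0 (testTranslate a φ)]
    congr 1; ext ξ
    rw [testFourier_testTranslate, map_mul, ← Complex.exp_conj, map_mul, Complex.conj_ofReal,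
      Complex.conj_I, smul_eq_mul, mul_assoc (Complex.exp _), real_inner_comm]
    congr 2
    push_cast; ring
  have h2 : ∀ n : ℕ, ∀ᵐ ξ : R3, ‖ξ‖ ≤ n → G ξ = 0 := by
    intro n
    obtain ⟨φ, hφ⟩ := exists_testFourier_ne_zero n
    filter_upwards [h1 φ] with ξ hξ hn
    rcases mul_eq_zero.1 hξ with h | h
    · exact absurd ((map_eq_zero _).1 h) (hφ ξ hn)
    · exact h
  filter_upwards [ae_all_iff.2 h2] with ξ hξ
  obtain ⟨n, hn⟩ := exists_nat_ge ‖ξ‖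
  exact hξ n hn

lemma integrable_conj_mul_of_memLp {f g : R3 → ℂ} (hf : MemLp f 2 volume)
    (hg : MemLp g 2 volume) : Integrable (fun ξ => conj (f ξ) * g ξ) := by
  have hf' : MemLp (fun ξ => conj (f ξ)) 2 volume := hf.star
  exact hf'.integrable_mul hg

/-- The eigenvalue equation in momentum space. -/
lemma ae_eigenvalue_equation {γ : ℝ} {E : ℂ} {f : R3 → ℂ} (hf : FiniteWeight f)
    (hf2 : MemLp f 2 volume)
    (h : ∀ φ : testFunctions, kineticForm (testFourier φ) f - γ * coulombForm (testFourier φ) f =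
      E * ∫ ξ, conj (testFourier φ ξ) * f ξ) :
    ∀ᵐ ξ, (kinetic (absMomentum ξ) : ℂ) * f ξ - E * f ξ = γ * coulombConv f ξ := by
  have key := ae_eq_zero_of_forall_testFourier
    (G := fun ξ => (kinetic (absMomentum ξ) : ℂ) * f ξ - E * f ξ - γ * coulombConv f ξ)
  have hφ := fun φ : testFunctions => finiteWeight_schwartz (testFourier φ)
  have i1 := fun φ => (hφ φ).integrable_kineticForm hf
  have i2 := fun φ : testFunctions =>
    (integrable_conj_mul_of_memLp ((testFourier φ).memLp 2 volume) hf2).const_mul E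
  have i3 := fun φ => ((hφ φ).integrable_conj_mul_conv hf).const_mul (γ : ℂ)
  have i12 : ∀ φ, Integrable (fun ξ => (kinetic (absMomentum ξ) : ℂ) *
      (conj (testFourier φ ξ) * f ξ) - E * (conj (testFourier φ ξ) * f ξ)) :=
    fun φ => (i1 φ).sub (i2 φ)
  have heq : ∀ (φ : testFunctions) (ξ : R3), conj (testFourier φ ξ) *
      ((kinetic (absMomentum ξ) : ℂ) * f ξ - E * f ξ - γ * coulombConv f ξ) =
      (kinetic (absMomentum ξ) : ℂ) * (conj (testFourier φ ξ) * f ξ) -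
        E * (conj (testFourier φ ξ) * f ξ) -
        γ * (conj (testFourier φ ξ) * coulombConv f ξ) := fun φ ξ => by ring
  have := key (fun φ => by
      simp_rw [heq]
      exact (i12 φ).sub (i3 φ)) (fun φ => by
      simp_rw [heq]
      rw [integral_sub (i12 φ) (i3 φ), integral_sub (i1 φ) (i2 φ),
        integral_const_mul, integral_const_mul, ← coulombForm_eq_integral_conv (hφ φ) hf, ← h φ]
      unfold kineticForm
      ring)
  filter_upwards [this] with ξ hξ
  exact sub_eq_zero.1 hξ

/-! ### Dilations and the virial theorem -/

/-- Dilating the argument by `r ≥ 1` pushes the volume forward to `r⁻³` times itself, a smaller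
measure. -/
lemma eLpNorm_comp_smul_le {g : R3 → ℂ} (hg : AEStronglyMeasurable g volume) {r : ℝ}
    (hr : 1 ≤ r) : eLpNorm (fun ξ => g (r • ξ)) 2 volume ≤ eLpNorm g 2 volume := by
  have hr0 : r ≠ 0 := by positivity
  have hle : Measure.map (fun x : R3 => r • x) volume ≤ volume := by
    rw [Measure.map_addHaar_smul volume hr0]
    refine Measure.le_iff.2 fun s _ => ?_
    rw [Measure.smul_apply, smul_eq_mul]
    refine mul_le_of_le_one_left' ?_
    rw [ENNReal.ofReal_le_one, abs_of_pos (by positivity)]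
    exact inv_le_one_of_one_le₀ (one_le_pow₀ hr)
  have hm : AEStronglyMeasurable g (Measure.map (fun x : R3 => r • x) volume) :=
    hg.mono_measure hle
  calc eLpNorm (fun ξ => g (r • ξ)) 2 volume
      = eLpNorm g 2 (Measure.map (fun x : R3 => r • x) volume) :=
        (eLpNorm_map_measure hm (by fun_prop)).symm
    _ ≤ eLpNorm g 2 volume := eLpNorm_mono_measure _ hle

lemma quasiMeasurePreserving_smul {r : ℝ} (hr : r ≠ 0) :
    Measure.QuasiMeasurePreserving (fun x : R3 => r • x) volume volume := by
  refine ⟨by fun_prop, ?_⟩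
  rw [Measure.map_addHaar_smul volume hr]
  exact Measure.smul_absolutelyContinuous

/-- Dominated convergence. Because `r n ≥ 1`, the dilates vanish outside the same ball as `g`, which
supplies a common integrable bound. -/
lemma tendsto_eLpNorm_dilation_of_hasCompactSupport {g : R3 → ℂ} (hg : Continuous g)
    (hc : HasCompactSupport g) {r : ℕ → ℝ} (hr1 : ∀ n, 1 ≤ r n) (hr : Tendsto r atTop (𝓝 1)) :
    Tendsto (fun n => eLpNorm (fun ξ => g (r n • ξ) - g ξ) 2 volume) atTop (𝓝 0) := by
  obtain ⟨M, hM⟩ := hc.exists_bound_of_continuous hg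
  obtain ⟨R, hR⟩ := hc.isCompact.isBounded.subset_closedBall 0
  have hz : ∀ ξ : R3, ξ ∉ Metric.closedBall (0 : R3) R → g ξ = 0 := fun ξ hξ =>
    image_eq_zero_of_notMem_tsupport fun h => hξ (hR h)
  have h2 : ∀ n, eLpNorm (fun ξ => g (r n • ξ) - g ξ) 2 volume =
      (∫⁻ ξ, ‖g (r n • ξ) - g ξ‖ₑ ^ 2) ^ (1 / 2 : ℝ) := fun n => by
    rw [eLpNorm_eq_lintegral_rpow_enorm_toReal (by norm_num) (by norm_num)]
    simp
  simp_rw [h2]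
  have hlim : Tendsto (fun n => ∫⁻ ξ : R3, ‖g (r n • ξ) - g ξ‖ₑ ^ 2) atTop
      (𝓝 (∫⁻ _ : R3, 0)) := by
    refine tendsto_lintegral_of_dominated_convergence
      (fun ξ => (Metric.closedBall (0 : R3) R).indicator
        (fun _ => (ENNReal.ofReal (2 * M)) ^ 2) ξ) (fun n => ?_) (fun n => ?_) ?_ ?_
    · exact Measurable.pow_const ((by fun_prop : Continuous
        fun ξ => g (r n • ξ) - g ξ).measurable.enorm) 2
    · refine Eventually.of_forall fun ξ => ?_
      by_cases hξ : ξ ∈ Metric.closedBall (0 : R3) R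
      · simp only [Set.indicator_of_mem hξ]
        gcongr
        rw [← ofReal_norm]
        refine ENNReal.ofReal_le_ofReal ((norm_sub_le _ _).trans ?_)
        linarith [hM ξ, hM (r n • ξ)]
      · have hξ' : r n • ξ ∉ Metric.closedBall (0 : R3) R := by
          rw [mem_closedBall_zero_iff, not_le] at hξ ⊢
          rw [norm_smul, Real.norm_of_nonneg (by linarith [hr1 n])]
          nlinarith [hr1 n, norm_nonneg ξ]
        simp [hz _ hξ, hz _ hξ']
    · rw [lintegral_indicator measurableSet_closedBall, setLIntegral_const]
      exact ENNReal.mul_ne_top (by finiteness) (measure_closedBall_lt_top).ne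
    · refine Eventually.of_forall fun ξ => ?_
      have h1 : Tendsto (fun n => g (r n • ξ) - g ξ) atTop (𝓝 0) := by
        have h3 : Tendsto (fun n => r n • ξ) atTop (𝓝 ξ) := by
          simpa using hr.smul_const ξ
        simpa using ((hg.tendsto ξ).comp h3).sub_const (g ξ)
      have h4 := ((ENNReal.continuous_pow 2).tendsto _).comp ((continuous_enorm.tendsto _).comp h1)
      simpa only [enorm_zero, ne_eq, OfNat.ofNat_ne_zero, not_false_eq_true, zero_pow] using! h4
  rw [lintegral_zero] at hlim
  have := (ENNReal.continuous_rpow_const (y := 1 / 2)).tendsto 0 |>.comp hlim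
  rw [ENNReal.zero_rpow_of_pos (by norm_num)] at this
  exact this

/-- Approximate by continuous functions of compact support; the dilations are contractions, so the
approximation error is uniform in `n`. -/
lemma tendsto_eLpNorm_dilation {f : R3 → ℂ} (hf : MemLp f 2 volume) {r : ℕ → ℝ}
    (hr1 : ∀ n, 1 ≤ r n) (hr : Tendsto r atTop (𝓝 1)) :
    Tendsto (fun n => eLpNorm (fun ξ => f (r n • ξ) - f ξ) 2 volume) atTop (𝓝 0) := by
  rw [ENNReal.tendsto_atTop_zero]
  intro ε hε
  have hε3 : ε / 3 ≠ 0 := (ENNReal.div_pos hε.ne' (by norm_num)).ne'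
  obtain ⟨g, hgc, hfg, hg, hgL⟩ := hf.exists_hasCompactSupport_eLpNorm_sub_le (by norm_num) hε3
  obtain ⟨N, hN⟩ := ENNReal.tendsto_atTop_zero.1
    (tendsto_eLpNorm_dilation_of_hasCompactSupport hg hgc hr1 hr) (ε / 3) (pos_iff_ne_zero.2 hε3)
  refine ⟨N, fun n hn => ?_⟩
  have hr0 : r n ≠ 0 := by have := hr1 n; positivity
  have hfgm : AEStronglyMeasurable (f - g) volume := hf.1.sub hgL.1
  have m1 : AEStronglyMeasurable (fun ξ => (f - g) (r n • ξ)) volume :=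
    hfgm.comp_quasiMeasurePreserving (quasiMeasurePreserving_smul hr0)
  have m2 : AEStronglyMeasurable (fun ξ => g (r n • ξ) - g ξ) volume :=
    Continuous.aestronglyMeasurable (by fun_prop)
  have hsplit : (fun ξ => f (r n • ξ) - f ξ) =
      ((fun ξ => (f - g) (r n • ξ)) + fun ξ => g (r n • ξ) - g ξ) - (f - g) := by
    ext ξ; simp only [Pi.add_apply, Pi.sub_apply]; ring
  rw [hsplit]
  calc eLpNorm (((fun ξ => (f - g) (r n • ξ)) + fun ξ => g (r n • ξ) - g ξ) - (f - g)) 2 volume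
      ≤ eLpNorm ((fun ξ => (f - g) (r n • ξ)) + fun ξ => g (r n • ξ) - g ξ) 2 volume +
        eLpNorm (f - g) 2 volume := eLpNorm_sub_le (m1.add m2) hfgm (by norm_num)
    _ ≤ (eLpNorm (fun ξ => (f - g) (r n • ξ)) 2 volume +
        eLpNorm (fun ξ => g (r n • ξ) - g ξ) 2 volume) + eLpNorm (f - g) 2 volume := by
        gcongr; exact eLpNorm_add_le m1 m2 (by norm_num)
    _ ≤ (ε / 3 + ε / 3) + ε / 3 := by
        gcongr
        · exact (eLpNorm_comp_smul_le hfgm (hr1 n)).trans hfg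
        · exact hN n hn
    _ = ε := ENNReal.add_thirds ε

/-- Scaling: the kernel is homogeneous of degree `-2` and the volume of degree `3`, so
multiplication by `1/|x|` has degree one in the dilation. -/
lemma coulombConv_dilation (g : R3 → ℂ) {r : ℝ} (hr : 0 < r) (p : R3) :
    coulombConv (fun ξ => g (r • ξ)) p = (r⁻¹ : ℂ) * coulombConv g (r • p) := by
  unfold coulombConv
  have hk : ∀ q : R3, (coulombKernel p q : ℂ) =
      (r : ℂ) ^ 2 * (coulombKernel (r • p) (r • q) : ℂ) := by
    intro q
    rw [← Complex.ofReal_pow, ← Complex.ofReal_mul]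
    congr 1
    unfold coulombKernel
    rw [← smul_sub, norm_smul, Real.norm_of_nonneg hr.le]
    by_cases h : ‖p - q‖ = 0
    · simp [h]
    · have := Real.pi_pos
      field_simp
  have h1 : ∀ q : R3, g (r • q) * (coulombKernel p q : ℂ) = (r : ℂ) ^ 2 *
      (fun q' => g q' * (coulombKernel (r • p) q' : ℂ)) (r • q) := fun q => by
    simp only; rw [hk]; ring
  simp_rw [h1]
  rw [integral_const_mul, Measure.integral_comp_smul volume
    (fun q' => g q' * (coulombKernel (r • p) q' : ℂ)) r, finrank_euclideanSpace_fin,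
    abs_of_pos (by positivity), Complex.real_smul, ← mul_assoc]
  congr 1
  have : (r : ℂ) ≠ 0 := by exact_mod_cast hr.ne'
  push_cast
  field_simp

lemma FiniteWeight.comp_smul {f : R3 → ℂ} (hf : FiniteWeight f) {r : ℝ} (hr : 0 < r) :
    FiniteWeight (fun ξ => f (r • ξ)) := by
  refine finiteWeight_of_integrable
    (hf.1.comp_quasiMeasurePreserving (quasiMeasurePreserving_smul hr.ne')) ?_
  have h := (integrable_comp_smul_iff volume (fun ξ => ‖ξ‖ * ‖f ξ‖ ^ 2) hr.ne').2 hf.integrable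
  refine (h.const_mul r⁻¹).congr (Eventually.of_forall fun ξ => ?_)
  simp only [norm_smul, Real.norm_of_nonneg hr.le]
  field_simp

lemma memLp_comp_smul {f : R3 → ℂ} (hf : MemLp f 2 volume) {r : ℝ} (hr : 1 ≤ r) :
    MemLp (fun ξ => f (r • ξ)) 2 volume :=
  ⟨hf.1.comp_quasiMeasurePreserving (quasiMeasurePreserving_smul (by positivity)),
    (eLpNorm_comp_smul_le hf.1 hr).trans_lt hf.2⟩

lemma kineticForm_sub_mul_eq_coulombForm {γ : ℝ} {E : ℂ} {f h : R3 → ℂ} (hf : FiniteWeight f)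
    (hf2 : MemLp f 2 volume) (hh : FiniteWeight h) (hh2 : MemLp h 2 volume)
    (heq : ∀ᵐ ξ, (kinetic (absMomentum ξ) : ℂ) * f ξ - E * f ξ = γ * coulombConv f ξ) :
    kineticForm h f - E * ∫ ξ, conj (h ξ) * f ξ = γ * coulombForm h f := by
  rw [coulombForm_eq_integral_conv hh hf, kineticForm, ← integral_const_mul, ← integral_const_mul,
    ← integral_sub (hh.integrable_kineticForm hf)
      ((integrable_conj_mul_of_memLp hh2 hf2).const_mul E)]
  refine integral_congr_ae ?_
  filter_upwards [heq] with ξ hξ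
  linear_combination (conj (h ξ)) * hξ

lemma integrable_norm_sq {f : R3 → ℂ} (hf2 : MemLp f 2 volume) :
    Integrable (fun ξ => ‖f ξ‖ ^ 2) := by
  simpa using hf2.integrable_norm_pow (by norm_num)

lemma integral_conj_mul_self (f : R3 → ℂ) :
    ∫ ξ, conj (f ξ) * f ξ = ((∫ ξ, ‖f ξ‖ ^ 2 : ℝ) : ℂ) := by
  rw [← integral_complex_ofReal]
  congr 1; ext ξ
  exact conj_mul_self_eq _

/-- Test the equation with `f` itself: both forms are Hermitian, so only the eigenvalue can
contribute an imaginary part. -/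
lemma eigenvalue_im_eq_zero {γ : ℝ} {E : ℂ} {f : R3 → ℂ} (hf : FiniteWeight f)
    (hf2 : MemLp f 2 volume) (hpos : 0 < ∫ ξ, ‖f ξ‖ ^ 2)
    (heq : ∀ᵐ ξ, (kinetic (absMomentum ξ) : ℂ) * f ξ - E * f ξ = γ * coulombConv f ξ) :
    E.im = 0 := by
  have h := congrArg Complex.im (kineticForm_sub_mul_eq_coulombForm hf hf2 hf hf2 heq)
  have hB : (coulombForm f f).im = 0 := Complex.conj_eq_iff_im.1 (conj_coulombForm f f)
  rw [kineticForm_self, integral_conj_mul_self, Complex.sub_im, Complex.ofReal_im,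
    Complex.im_ofReal_mul, hB, Complex.im_mul_ofReal] at h
  have h2 : E.im * ∫ ξ, ‖f ξ‖ ^ 2 = 0 := by linarith
  exact (mul_eq_zero.1 h2).resolve_right hpos.ne'

/-- The difference quotient at `1` of `r ↦ kinetic (r s) / r`, up to the factor `-r`. -/
def virialSymbol (r s : ℝ) : ℝ := (r + 1) / (r * √(s ^ 2 + 1) + √((r * s) ^ 2 + 1)) - 1

/-- Rationalisation: with `a = √(s² + 1)` and `b = √((rs)² + 1)` one has `r² a² - b² = r² - 1`, so a
factor `r - 1` splits off explicitly and the quotient remains bounded. -/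
lemma sub_mul_virialSymbol {r : ℝ} (hr : 0 < r) (s : ℝ) :
    (r - 1) * virialSymbol r s = r * kinetic s - kinetic (r * s) := by
  unfold virialSymbol kinetic
  have h1 : 0 < √(s ^ 2 + 1) := by positivity
  have h2 : 0 < √((r * s) ^ 2 + 1) := by positivity
  have h3 : √(s ^ 2 + 1) ^ 2 = s ^ 2 + 1 := Real.sq_sqrt (by positivity)
  have h4 : √((r * s) ^ 2 + 1) ^ 2 = (r * s) ^ 2 + 1 := Real.sq_sqrt (by positivity)
  have h5 : 0 < r * √(s ^ 2 + 1) + √((r * s) ^ 2 + 1) := by positivity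
  set a := √(s ^ 2 + 1)
  set b := √((r * s) ^ 2 + 1)
  field_simp
  linear_combination (-r ^ 2) * h3 + h4

lemma abs_virialSymbol_le {r : ℝ} (hr : 0 < r) (s : ℝ) : |virialSymbol r s| ≤ 1 := by
  unfold virialSymbol
  have h1 : 1 ≤ √(s ^ 2 + 1) := Real.one_le_sqrt.2 (by nlinarith [sq_nonneg s])
  have h2 : 1 ≤ √((r * s) ^ 2 + 1) := Real.one_le_sqrt.2 (by nlinarith [sq_nonneg (r * s)])
  have h3 : r + 1 ≤ r * √(s ^ 2 + 1) + √((r * s) ^ 2 + 1) := by nlinarith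
  have h4 : (r + 1) / (r * √(s ^ 2 + 1) + √((r * s) ^ 2 + 1)) ≤ 1 :=
    (div_le_one (by linarith)).2 h3
  have h5 : 0 ≤ (r + 1) / (r * √(s ^ 2 + 1) + √((r * s) ^ 2 + 1)) := by positivity
  rw [abs_le]
  constructor <;> linarith

lemma kineticDefect_eq (s : ℝ) : kineticDefect s = 1 - (√(s ^ 2 + 1))⁻¹ := by
  unfold kineticDefect
  rw [Real.rpow_neg (by positivity), ← Real.sqrt_eq_rpow]

lemma tendsto_virialSymbol {r : ℕ → ℝ} (hr : Tendsto r atTop (𝓝 1)) (s : ℝ) :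
    Tendsto (fun n => virialSymbol (r n) s) atTop (𝓝 (-kineticDefect s)) := by
  have h1 : 0 < √(s ^ 2 + 1) := by positivity
  have hc : ContinuousAt (fun r => virialSymbol r s) 1 := by
    unfold virialSymbol
    refine ContinuousAt.sub (ContinuousAt.div (by fun_prop) (by fun_prop) ?_) continuousAt_const
    positivity
  have hv : virialSymbol 1 s = -kineticDefect s := by
    rw [kineticDefect_eq]
    unfold virialSymbol
    rw [one_mul, one_mul]
    field_simp
    ring
  rw [← hv]
  exact hc.tendsto.comp hr

/-- The same number `r γ B(f_r, f)`, with `f_r = f (r • ·)`, is computed twice: from the equation at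
`ξ` tested with `f_r`, and from the equation at `r • ξ` tested with `f`. The difference has the
factor `r - 1`, which is nonzero and cancels. -/
lemma virial_dilation {γ e : ℝ} {f : R3 → ℂ} (hf : FiniteWeight f) (hf2 : MemLp f 2 volume)
    (heq : ∀ᵐ ξ, (kinetic (absMomentum ξ) : ℂ) * f ξ - (e : ℂ) * f ξ = γ * coulombConv f ξ)
    {r : ℝ} (hr : 1 < r) :
    ∫ ξ, ((virialSymbol r (absMomentum ξ) - e : ℝ) : ℂ) * (conj (f (r • ξ)) * f ξ) = 0 := by
  have hr0 : 0 < r := by linarith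
  have hrc : (r : ℂ) ≠ 0 := by exact_mod_cast hr0.ne'
  have hfr := hf.comp_smul hr0
  have hfr2 := memLp_comp_smul hf2 hr.le
  have h1 := kineticForm_sub_mul_eq_coulombForm hf hf2 hfr hfr2 heq
  have i1 := hfr.integrable_kineticForm hf
  have i2 := integrable_conj_mul_of_memLp hfr2 hf2
  have hae := (quasiMeasurePreserving_smul hr0.ne').ae heq
  have h2 : (r : ℂ) * (γ * coulombForm (fun ξ => f (r • ξ)) f) =
      ∫ ξ, ((kinetic (absMomentum (r • ξ)) : ℂ) - e) * (conj (f (r • ξ)) * f ξ) := by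
    rw [← conj_coulombForm, coulombForm_eq_integral_conv hf hfr, ← integral_conj,
      ← integral_const_mul, ← integral_const_mul]
    refine integral_congr_ae ?_
    filter_upwards [hae] with ξ hξ
    rw [coulombConv_dilation f hr0]
    have hξ' := congrArg (starRingEnd ℂ) hξ
    simp only [map_sub, map_mul, Complex.conj_ofReal] at hξ'
    simp only [map_mul, Complex.conj_conj, map_inv₀, Complex.conj_ofReal]
    field_simp
    linear_combination (-f ξ) * hξ'
  have h3 : (r : ℂ) * (γ * coulombForm (fun ξ => f (r • ξ)) f) =
      ∫ ξ, (r : ℂ) * ((kinetic (absMomentum ξ) : ℂ) * (conj (f (r • ξ)) * f ξ) -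
        e * (conj (f (r • ξ)) * f ξ)) := by
    rw [← h1, integral_const_mul, integral_sub i1 (i2.const_mul _), integral_const_mul]
    rfl
  have i3 : Integrable (fun ξ => (r : ℂ) * ((kinetic (absMomentum ξ) : ℂ) *
      (conj (f (r • ξ)) * f ξ) - e * (conj (f (r • ξ)) * f ξ))) :=
    (i1.sub (i2.const_mul _)).const_mul _
  have i4 : Integrable (fun ξ => ((virialSymbol r (absMomentum ξ) - e : ℝ) : ℂ) *
      (conj (f (r • ξ)) * f ξ)) := by
    refine i2.bdd_mul (c := 1 + |e|) ?_ (Eventually.of_forall fun ξ => ?_)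
    · have : Measurable (fun ξ => virialSymbol r (absMomentum ξ) - e) := by
        have := measurable_absMomentum
        unfold virialSymbol
        fun_prop
      exact (Complex.measurable_ofReal.comp this).aestronglyMeasurable
    · rw [Complex.norm_real, Real.norm_eq_abs]
      exact (abs_sub _ _).trans (by gcongr; exact abs_virialSymbol_le hr0 _)
  have hpt : ∀ ξ, ((kinetic (absMomentum (r • ξ)) : ℂ) - e) * (conj (f (r • ξ)) * f ξ) =
      (r : ℂ) * ((kinetic (absMomentum ξ) : ℂ) *
      (conj (f (r • ξ)) * f ξ) - e * (conj (f (r • ξ)) * f ξ)) -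
      ((r - 1 : ℝ) : ℂ) * (((virialSymbol r (absMomentum ξ) - e : ℝ) : ℂ) *
      (conj (f (r • ξ)) * f ξ)) := by
    intro ξ
    have hs := sub_mul_virialSymbol hr0 (absMomentum ξ)
    have habs : absMomentum (r • ξ) = r * absMomentum ξ := by
      unfold absMomentum
      rw [norm_smul, Real.norm_of_nonneg hr0.le]; ring
    rw [habs]
    have hs' : ((r : ℂ) - 1) * (virialSymbol r (absMomentum ξ) : ℂ) =
        r * (kinetic (absMomentum ξ) : ℂ) - (kinetic (r * absMomentum ξ) : ℂ) := by
      exact_mod_cast hs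
    push_cast
    linear_combination (conj (f (r • ξ)) * f ξ) * hs'
  rw [h3] at h2
  simp_rw [hpt] at h2
  rw [integral_sub i3 (i4.const_mul _), integral_const_mul ((r - 1 : ℝ) : ℂ)] at h2
  have h5 : ((r - 1 : ℝ) : ℂ) * ∫ ξ, ((virialSymbol r (absMomentum ξ) - e : ℝ) : ℂ) *
      (conj (f (r • ξ)) * f ξ) = 0 := by
    linear_combination h2
  refine (mul_eq_zero.1 h5).resolve_left ?_
  exact_mod_cast (sub_pos.2 hr).ne'

lemma abs_kineticDefect_le (s : ℝ) : |kineticDefect s| ≤ 1 := by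
  rw [kineticDefect_eq]
  have h1 : 1 ≤ √(s ^ 2 + 1) := Real.one_le_sqrt.2 (by nlinarith [sq_nonneg s])
  have h2 : (√(s ^ 2 + 1))⁻¹ ≤ 1 := inv_le_one_of_one_le₀ h1
  have h3 : 0 ≤ (√(s ^ 2 + 1))⁻¹ := by positivity
  rw [abs_le]
  constructor <;> linarith

lemma measurable_kineticDefect_absMomentum :
    Measurable (fun ξ => kineticDefect (absMomentum ξ)) := by
  have := measurable_absMomentum
  simp only [kineticDefect_eq]
  fun_prop

lemma integrable_kineticDefect {f : R3 → ℂ} (hf2 : MemLp f 2 volume) :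
    Integrable (fun ξ => kineticDefect (absMomentum ξ) * ‖f ξ‖ ^ 2) :=
  (integrable_norm_sq hf2).bdd_mul (c := 1)
    measurable_kineticDefect_absMomentum.aestronglyMeasurable
    (Eventually.of_forall fun _ => abs_kineticDefect_le _)

/-- The virial theorem. -/
lemma virial {γ e : ℝ} {f : R3 → ℂ} (hf : FiniteWeight f) (hf2 : MemLp f 2 volume)
    (heq : ∀ᵐ ξ, (kinetic (absMomentum ξ) : ℂ) * f ξ - (e : ℂ) * f ξ = γ * coulombConv f ξ) :
    e * ∫ ξ, ‖f ξ‖ ^ 2 = -∫ ξ, kineticDefect (absMomentum ξ) * ‖f ξ‖ ^ 2 := by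
  set r : ℕ → ℝ := fun n => 1 + 1 / ((n : ℝ) + 1) with hrdef
  have hr1 : ∀ n, 1 < r n := fun n => by
    simp only [hrdef]; linarith [show (0 : ℝ) < 1 / ((n : ℝ) + 1) by positivity]
  have hr : Tendsto r atTop (𝓝 1) := by
    simpa only [add_zero] using
      (tendsto_one_div_add_atTop_nhds_zero_nat (𝕜 := ℝ)).const_add (1 : ℝ)
  set c : ℕ → R3 → ℂ := fun n ξ => ((virialSymbol (r n) (absMomentum ξ) - e : ℝ) : ℂ) with hc
  have hcm : ∀ n, AEStronglyMeasurable (c n) volume := fun n => by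
    have : Measurable (fun ξ => virialSymbol (r n) (absMomentum ξ) - e) := by
      have := measurable_absMomentum
      unfold virialSymbol
      fun_prop
    exact (Complex.measurable_ofReal.comp this).aestronglyMeasurable
  have hcb : ∀ n ξ, ‖c n ξ‖ ≤ 1 + |e| := fun n ξ => by
    rw [Complex.norm_real, Real.norm_eq_abs]
    exact (abs_sub _ _).trans (by gcongr; exact abs_virialSymbol_le (by linarith [hr1 n]) _)
  have hi := integrable_conj_mul_of_memLp hf2 hf2
  have hir := fun n => integrable_conj_mul_of_memLp (memLp_comp_smul hf2 (hr1 n).le) hf2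
  have hlim1 : Tendsto (fun n => ∫ ξ, c n ξ * (conj (f ξ) * f ξ)) atTop
      (𝓝 (∫ ξ, ((-kineticDefect (absMomentum ξ) - e : ℝ) : ℂ) * (conj (f ξ) * f ξ))) := by
    refine tendsto_integral_of_dominated_convergence
      (fun ξ => (1 + |e|) * ‖conj (f ξ) * f ξ‖) (fun n => (hcm n).mul hi.1) (hi.norm.const_mul _)
      (fun n => Eventually.of_forall fun ξ => ?_) (Eventually.of_forall fun ξ => ?_)
    · rw [norm_mul]
      exact mul_le_mul_of_nonneg_right (hcb n ξ) (norm_nonneg _)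
    · refine Tendsto.mul_const _ ?_
      exact (Complex.continuous_ofReal.tendsto _).comp
        ((tendsto_virialSymbol hr (absMomentum ξ)).sub_const e)
  -- By `virial_dilation` the term with the dilate vanishes, so only `f (r n • ·) - f` survives. It
  -- tends to zero by Cauchy–Schwarz and the uniform bound `1 + |e|` on the multiplier.
  have hlim2 : Tendsto (fun n => ∫ ξ, c n ξ * (conj (f ξ) * f ξ)) atTop (𝓝 0) := by
    have heq0 : ∀ n, ∫ ξ, c n ξ * (conj (f ξ) * f ξ) =
        -∫ ξ, c n ξ * (conj (f (r n • ξ) - f ξ) * f ξ) := by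
      intro n
      have h0 := virial_dilation hf hf2 heq (hr1 n)
      have hs : ∀ ξ, c n ξ * (conj (f (r n • ξ) - f ξ) * f ξ) =
          c n ξ * (conj (f (r n • ξ)) * f ξ) - c n ξ * (conj (f ξ) * f ξ) := fun ξ => by
        rw [map_sub]; ring
      simp_rw [hs]
      rw [integral_sub ((hir n).bdd_mul (hcm n) (Eventually.of_forall (hcb n)))
        (hi.bdd_mul (hcm n) (Eventually.of_forall (hcb n))), h0, zero_sub, neg_neg]
    rw [tendsto_iff_edist_tendsto_0]
    have h0 := ENNReal.Tendsto.const_mul (a := ENNReal.ofReal (1 + |e|) * eLpNorm f 2 volume)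
      (tendsto_eLpNorm_dilation hf2 (fun n => (hr1 n).le) hr)
      (Or.inr (ENNReal.mul_ne_top ENNReal.ofReal_ne_top hf2.2.ne))
    rw [mul_zero] at h0
    refine tendsto_of_tendsto_of_tendsto_of_le_of_le tendsto_const_nhds h0
      (fun n => zero_le) fun n => ?_
    simp only [edist_eq_enorm_sub, sub_zero, heq0, enorm_neg]
    refine (enorm_integral_le_lintegral_enorm _).trans ?_
    have hfm : AEMeasurable (fun ξ => ‖f (r n • ξ) - f ξ‖ₑ) :=
      ((memLp_comp_smul hf2 (hr1 n).le).1.sub hf2.1).enorm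
    have hCS := lintegral_sq_mul_rpow_half hfm hf2.1.enorm
    have e1 : ∀ g : R3 → ℂ, (∫⁻ ξ, ‖g ξ‖ₑ ^ 2) ^ (1 / 2 : ℝ) = eLpNorm g 2 volume := fun g => by
      rw [eLpNorm_eq_lintegral_rpow_enorm_toReal (by norm_num) (by norm_num)]
      simp
    rw [e1 (fun ξ => f (r n • ξ) - f ξ), e1] at hCS
    calc ∫⁻ ξ, ‖c n ξ * (conj (f (r n • ξ) - f ξ) * f ξ)‖ₑ
        ≤ ∫⁻ ξ, ENNReal.ofReal (1 + |e|) * (‖f (r n • ξ) - f ξ‖ₑ * ‖f ξ‖ₑ) := by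
          refine lintegral_mono fun ξ => ?_
          rw [enorm_mul, enorm_mul, RCLike.enorm_conj]
          gcongr
          rw [← ofReal_norm]
          exact ENNReal.ofReal_le_ofReal (hcb n ξ)
      _ ≤ _ := by
          rw [lintegral_const_mul' _ _ ENNReal.ofReal_ne_top, mul_assoc]
          gcongr
          rw [mul_comm (eLpNorm f 2 volume)]
          exact hCS
  have hfin := tendsto_nhds_unique hlim1 hlim2
  have hreal : ∀ ξ, ((-kineticDefect (absMomentum ξ) - e : ℝ) : ℂ) * (conj (f ξ) * f ξ) =
      ((-(kineticDefect (absMomentum ξ) * ‖f ξ‖ ^ 2) - e * ‖f ξ‖ ^ 2 : ℝ) : ℂ) := fun ξ => by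
    rw [conj_mul_self_eq, ← Complex.ofReal_mul]
    congr 1; ring
  simp_rw [hreal] at hfin
  have hD : Integrable (fun ξ => -(kineticDefect (absMomentum ξ) * ‖f ξ‖ ^ 2)) :=
    (integrable_kineticDefect hf2).neg
  rw [integral_complex_ofReal, integral_sub hD ((integrable_norm_sq hf2).const_mul e), integral_neg, integral_const_mul] at hfin
  have h9 := Complex.ofReal_eq_zero.1 hfin
  linarith

/-! ### Splitting into low and high momenta -/

/-- With `w = √(s² + 1)` the ratio of the two symbols is `w` (for `w ≠ 1`), and `w ≤ √2 ≤ 3/2`. -/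
lemma kinetic_le_of_le_one {s : ℝ} (hs0 : 0 ≤ s) (hs : s ≤ 1) :
    kinetic s ≤ 3 / 2 * kineticDefect s := by
  rw [kineticDefect_eq, kinetic]
  have h1 : 1 ≤ √(s ^ 2 + 1) := Real.one_le_sqrt.2 (by nlinarith)
  have h2 : √(s ^ 2 + 1) ≤ 3 / 2 := Real.sqrt_le_iff.2 ⟨by norm_num, by nlinarith⟩
  set w := √(s ^ 2 + 1)
  have h3 : w - 1 = w * (1 - w⁻¹) := by field_simp
  have h4 : 0 ≤ 1 - w⁻¹ := sub_nonneg.2 (inv_le_one_of_one_le₀ h1)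
  rw [h3]
  exact mul_le_mul_of_nonneg_right h2 h4

lemma le_kinetic_add_kineticDefect {s : ℝ} (hs : 1 ≤ s) :
    s ≤ kinetic s + 2 * kineticDefect s := by
  rw [kineticDefect_eq, kinetic]
  have h0 : √(s ^ 2 + 1) ^ 2 = s ^ 2 + 1 := Real.sq_sqrt (by positivity)
  have h1 : 1 ≤ √(s ^ 2 + 1) := Real.one_le_sqrt.2 (by nlinarith)
  set w := √(s ^ 2 + 1)
  have hw : 0 < w := by linarith
  -- After squaring, with `s² = w² - 1`, the difference of the two sides is `2 (w - 1)(w² - 2)`.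
  -- This is where `s ≥ 1`, that is `w² ≥ 2`, enters; equality holds at `s = 1`.
  have hle : s * w ≤ w ^ 2 + w - 2 := by
    refine abs_le_of_sq_le_sq' ?_ (by nlinarith) |>.2
    have hs2 : s ^ 2 = w ^ 2 - 1 := by linarith
    rw [mul_pow, hs2]
    have hw2 : 2 ≤ w ^ 2 := by nlinarith
    nlinarith [mul_nonneg (sub_nonneg.2 h1) (sub_nonneg.2 hw2)]
  have : s ≤ (w ^ 2 + w - 2) / w := (le_div_iff₀ hw).2 hle
  refine this.trans (le_of_eq ?_)
  field_simp
  ring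

lemma kineticDefect_nonneg (s : ℝ) : 0 ≤ kineticDefect s := by
  rw [kineticDefect_eq]
  exact sub_nonneg.2 (inv_le_one_of_one_le₀ (Real.one_le_sqrt.2 (by nlinarith [sq_nonneg s])))

lemma four_le_constA : 4 ≤ constA := by
  unfold constA
  have h1 : (2 : ℝ) ^ (3 / 2 : ℝ) = 2 * √2 := by
    rw [show (3 / 2 : ℝ) = 1 + 1 / 2 by norm_num, Real.rpow_add (by norm_num), Real.rpow_one,
      ← Real.sqrt_eq_rpow]
  have h2 : √2 ^ 2 = (2 : ℝ) := Real.sq_sqrt (by norm_num)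
  have h3 : 1.414 < √2 := Real.lt_sqrt_of_sq_lt (by norm_num)
  have h4 : √2 < 1.415 := (Real.sqrt_lt' (by norm_num)).2 (by norm_num)
  have h5 := Real.pi_lt_d2
  have h6 := Real.pi_pos
  have h7 : 0 < Real.pi * (√2 - 1) := mul_pos h6 (by linarith)
  rw [h1]
  have : 2 ≤ 2 * √2 / (Real.pi * (√2 - 1)) := by
    rw [le_div_iff₀ h7]
    nlinarith
  linarith

/-- Supplies the integrability that positivity of the Coulomb form asks of the low-momentum part. -/
lemma integrable_indicator_of_memLp {f : R3 → ℂ} (hf2 : MemLp f 2 volume) {S : Set R3}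
    (hS : MeasurableSet S) (hS' : volume S ≠ ⊤) : Integrable (S.indicator f) := by
  rw [integrable_indicator_iff hS]
  have : IsFiniteMeasure (volume.restrict S) := ⟨by
    rw [Measure.restrict_apply_univ]; exact hS'.lt_top⟩
  exact (hf2.restrict S).integrable (by norm_num)

lemma volume_absMomentum_le_one_ne_top : volume {ξ : R3 | absMomentum ξ ≤ 1} ≠ ⊤ := by
  refine ne_top_of_le_ne_top
    (measure_closedBall_lt_top (μ := volume) (x := (0 : R3)) (r := 1)).ne (measure_mono ?_)
  intro ξ hξ
  have h1 : 2 * Real.pi * ‖ξ‖ ≤ 1 := hξ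
  rw [mem_closedBall_zero_iff]
  nlinarith [Real.pi_gt_three, norm_nonneg ξ]

lemma conj_indicator_mul (f : R3 → ℂ) (S : Set R3) (ξ : R3) :
    conj (S.indicator f ξ) * f ξ = conj (S.indicator f ξ) * S.indicator f ξ := by
  by_cases h : ξ ∈ S <;> simp [h]

lemma integral_eq_add_indicator {m : R3 → ℝ} {f : R3 → ℂ} {S : Set R3} (hS : MeasurableSet S)
    (hi : Integrable (fun ξ => m ξ * ‖f ξ‖ ^ 2)) :
    ∫ ξ, m ξ * ‖f ξ‖ ^ 2 =
      (∫ ξ, m ξ * ‖S.indicator f ξ‖ ^ 2) + ∫ ξ, m ξ * ‖Sᶜ.indicator f ξ‖ ^ 2 := by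
  have h : ∀ T : Set R3, MeasurableSet T → ∫ ξ, m ξ * ‖T.indicator f ξ‖ ^ 2 =
      ∫ ξ in T, m ξ * ‖f ξ‖ ^ 2 := fun T hT => by
    rw [← integral_indicator hT]
    congr 1; ext ξ
    by_cases hξ : ξ ∈ T <;> simp [hξ]
  rw [h S hS, h Sᶜ hS.compl, integral_add_compl hS hi]

lemma re_eigenvalue_identity {γ e : ℝ} {f : R3 → ℂ} (hf : FiniteWeight f)
    (hf2 : MemLp f 2 volume)
    (heq : ∀ᵐ ξ, (kinetic (absMomentum ξ) : ℂ) * f ξ - (e : ℂ) * f ξ = γ * coulombConv f ξ)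
    {S : Set R3} (hS : MeasurableSet S) :
    (∫ ξ, kinetic (absMomentum ξ) * ‖S.indicator f ξ‖ ^ 2) -
        e * ∫ ξ, ‖S.indicator f ξ‖ ^ 2 =
      γ * (coulombForm (S.indicator f) f).re := by
  have h := kineticForm_sub_mul_eq_coulombForm hf hf2 (hf.indicator hS) (hf2.indicator hS) heq
  have h1 : kineticForm (S.indicator f) f = kineticForm (S.indicator f) (S.indicator f) := by
    unfold kineticForm
    simp_rw [conj_indicator_mul f S]
  simp_rw [conj_indicator_mul f S] at h
  rw [h1, kineticForm_self, integral_conj_mul_self] at h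
  have h2 := congrArg Complex.re h
  rwa [Complex.sub_re, Complex.ofReal_re, Complex.re_ofReal_mul, Complex.ofReal_re,
    Complex.re_ofReal_mul] at h2

/-- Subtracting the low-momentum identity from the high-momentum one cancels the mixed Coulomb
terms, whose real parts agree. The low Coulomb energy then has a favourable sign, and Kato's
inequality is used only at high momenta, where replacing `|p|` by the kinetic energy costs just a
multiple of the defect. -/
lemma integral_kinetic_le {γ e : ℝ} (hγ0 : 0 < γ) (hγ1 : γ < 2 / Real.pi) {f : R3 → ℂ}
    (hf : FiniteWeight f) (hf2 : MemLp f 2 volume)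
    (heq : ∀ᵐ ξ, (kinetic (absMomentum ξ) : ℂ) * f ξ - (e : ℂ) * f ξ = γ * coulombConv f ξ)
    (hpos : 0 < ∫ ξ, ‖f ξ‖ ^ 2) :
    (1 - γ * Real.pi / 2) * ∫ ξ, kinetic (absMomentum ξ) * ‖f ξ‖ ^ 2 ≤
      4 * ∫ ξ, kineticDefect (absMomentum ξ) * ‖f ξ‖ ^ 2 := by
  have hpi := Real.pi_pos
  set S : Set R3 := {ξ | absMomentum ξ ≤ 1}
  have hS : MeasurableSet S := measurable_absMomentum measurableSet_Iic
  have hvir := virial hf hf2 heq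
  have hlow := re_eigenvalue_identity hf hf2 heq hS
  have hhigh := re_eigenvalue_identity hf hf2 heq hS.compl
  have hK := integral_eq_add_indicator hS hf.integrable_kinetic
  have hD := integral_eq_add_indicator hS (integrable_kineticDefect hf2)
  have hN := integral_eq_add_indicator (m := fun _ => 1) hS
    (by simpa only [one_mul] using integrable_norm_sq hf2)
  simp only [one_mul] at hN
  have hg := hf.indicator hS
  have hh := hf.indicator hS.compl
  have hg2 := hf2.indicator hS
  have hh2 := hf2.indicator hS.compl
  have hsum : f = fun ξ => S.indicator f ξ + Sᶜ.indicator f ξ :=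
    (Set.indicator_self_add_compl S f).symm
  have hBg : coulombForm (S.indicator f) f = coulombForm (S.indicator f) (S.indicator f) +
      coulombForm (S.indicator f) (Sᶜ.indicator f) := by
    rw [← coulombForm_add_right hg hh hg, ← hsum]
  have hBh : coulombForm (Sᶜ.indicator f) f = coulombForm (Sᶜ.indicator f) (S.indicator f) +
      coulombForm (Sᶜ.indicator f) (Sᶜ.indicator f) := by
    rw [← coulombForm_add_right hg hh hh, ← hsum]
  have hsymm : (coulombForm (S.indicator f) (Sᶜ.indicator f)).re =
      (coulombForm (Sᶜ.indicator f) (S.indicator f)).re := by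
    rw [← conj_coulombForm, Complex.conj_re]
  have hBgg : 0 ≤ (coulombForm (S.indicator f) (S.indicator f)).re :=
    hg.re_coulombForm_self_nonneg
      (integrable_indicator_of_memLp hf2 hS volume_absMomentum_le_one_ne_top)
  have hBhh := (Complex.re_le_norm _).trans hh.norm_coulombForm_self_le
  rw [hh.weightNorm_toReal] at hBhh
  have hP : 2 * Real.pi * ∫ ξ, ‖ξ‖ * ‖Sᶜ.indicator f ξ‖ ^ 2 ≤
      (∫ ξ, kinetic (absMomentum ξ) * ‖Sᶜ.indicator f ξ‖ ^ 2) +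
      2 * ∫ ξ, kineticDefect (absMomentum ξ) * ‖Sᶜ.indicator f ξ‖ ^ 2 := by
    rw [← integral_const_mul, ← integral_const_mul,
      ← integral_add hh.integrable_kinetic ((integrable_kineticDefect hh2).const_mul 2)]
    refine integral_mono (hh.integrable.const_mul _)
      (hh.integrable_kinetic.add ((integrable_kineticDefect hh2).const_mul 2)) fun ξ => ?_
    by_cases hξ : ξ ∈ S
    · simp [hξ]
    · have h1 : 1 ≤ absMomentum ξ := (not_le.1 hξ).le
      have h2 := mul_le_mul_of_nonneg_right (le_kinetic_add_kineticDefect h1)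
        (sq_nonneg ‖Sᶜ.indicator f ξ‖)
      have h3 : absMomentum ξ = 2 * Real.pi * ‖ξ‖ := rfl
      simp only
      linear_combination h2 - (‖Sᶜ.indicator f ξ‖ ^ 2) * h3
  have hKlow : ∫ ξ, kinetic (absMomentum ξ) * ‖S.indicator f ξ‖ ^ 2 ≤
      3 / 2 * ∫ ξ, kineticDefect (absMomentum ξ) * ‖S.indicator f ξ‖ ^ 2 := by
    rw [← integral_const_mul]
    refine integral_mono hg.integrable_kinetic ((integrable_kineticDefect hg2).const_mul _)
      fun ξ => ?_
    by_cases hξ : ξ ∈ S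
    · have h2 := mul_le_mul_of_nonneg_right (kinetic_le_of_le_one (absMomentum_nonneg ξ) hξ)
        (sq_nonneg ‖S.indicator f ξ‖)
      simp only
      linarith
    · simp [hξ]
  have hnn : ∀ {m : ℝ → ℝ} (T : Set R3), (∀ s, 0 ≤ m s) →
      0 ≤ ∫ ξ, m (absMomentum ξ) * ‖T.indicator f ξ‖ ^ 2 := fun T hm =>
    integral_nonneg fun ξ => mul_nonneg (hm _) (by positivity)
  have hKg := hnn S kinetic_nonneg
  have hKh := hnn Sᶜ kinetic_nonneg
  have hDg := hnn S kineticDefect_nonneg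
  have hDh := hnn Sᶜ kineticDefect_nonneg
  have hNg : 0 ≤ ∫ ξ, ‖S.indicator f ξ‖ ^ 2 := integral_nonneg fun ξ => by positivity
  have hNh : 0 ≤ ∫ ξ, ‖Sᶜ.indicator f ξ‖ ^ 2 := integral_nonneg fun ξ => by positivity
  rw [hBg, Complex.add_re] at hlow
  rw [hBh, Complex.add_re] at hhigh
  rw [hN, hD] at hvir
  rw [hN] at hpos
  rw [hK, hD]
  have hγpi : γ * Real.pi < 2 := (lt_div_iff₀ hpi).1 hγ1
  set Kg := ∫ ξ, kinetic (absMomentum ξ) * ‖S.indicator f ξ‖ ^ 2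
  set Kh := ∫ ξ, kinetic (absMomentum ξ) * ‖Sᶜ.indicator f ξ‖ ^ 2
  set Dg := ∫ ξ, kineticDefect (absMomentum ξ) * ‖S.indicator f ξ‖ ^ 2
  set Dh := ∫ ξ, kineticDefect (absMomentum ξ) * ‖Sᶜ.indicator f ξ‖ ^ 2
  set Ng := ∫ ξ, ‖S.indicator f ξ‖ ^ 2
  set Nh := ∫ ξ, ‖Sᶜ.indicator f ξ‖ ^ 2
  set P := ∫ ξ, ‖ξ‖ * ‖Sᶜ.indicator f ξ‖ ^ 2
  -- The virial theorem expresses `e N` as minus a nonnegative quantity, and `N > 0`.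
  have he : e ≤ 0 := by
    by_contra hcon
    have := mul_pos (not_le.1 hcon) hpos
    linarith
  have heNh : e * Nh ≤ 0 := mul_nonpos_of_nonpos_of_nonneg he hNh
  have hBhh' : γ * (coulombForm (Sᶜ.indicator f) (Sᶜ.indicator f)).re ≤
      γ * Real.pi / 2 * (Kh + 2 * Dh) := by
    calc γ * (coulombForm (Sᶜ.indicator f) (Sᶜ.indicator f)).re
        ≤ γ * (Real.pi ^ 2 * P) := mul_le_mul_of_nonneg_left hBhh hγ0.le
      _ = γ * Real.pi / 2 * (2 * Real.pi * P) := by ring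
      _ ≤ _ := mul_le_mul_of_nonneg_left hP (by positivity)
  have hBgg' := mul_nonneg hγ0.le hBgg
  have hc0 : 0 < γ * Real.pi / 2 := by positivity
  have hc1 : γ * Real.pi / 2 < 1 := by linarith
  rw [hsymm] at hlow
  have hDh' : γ * Real.pi / 2 * (2 * Dh) ≤ 2 * Dh := by nlinarith
  have hKg' : (1 - γ * Real.pi / 2) * Kg ≤ Kg := by nlinarith
  -- Put `c = γπ/2`. The difference of the identities gives `(1 - c) Kh ≤ Kg + e (Nh - Ng) + 2 Dh`,
  -- and the virial theorem gives `e (Nh - Ng) = Dg + Dh + 2 e Nh ≤ Dg + Dh`. Adding `(1 - c) Kg ≤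
  -- Kg` and using `Kg ≤ 3/2 Dg` bounds the total by `4 Dg + 3 Dh`.
  nlinarith

lemma integral_norm_sq_fourier_pos {ψ : L2R3} (hψ : ψ ≠ 0) :
    0 < ∫ ξ, ‖(𝓕 ψ : L2R3) ξ‖ ^ 2 := by
  have h0 : 0 ≤ ∫ ξ, ‖(𝓕 ψ : L2R3) ξ‖ ^ 2 := integral_nonneg fun ξ => by positivity
  refine lt_of_le_of_ne h0 fun h => hψ ?_
  have h1 := (integral_eq_zero_iff_of_nonneg (fun ξ => by positivity)
    (integrable_norm_sq (Lp.memLp (𝓕 ψ : L2R3)))).1 h.symm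
  have h2 : (𝓕 ψ : L2R3) = 0 := by
    rw [Lp.eq_zero_iff_ae_eq_zero]
    filter_upwards [h1] with ξ hξ
    simpa using hξ
  rw [← norm_eq_zero, ← Lp.norm_fourier_eq, h2, norm_zero]

end Chandrasekhar

end

theorem mainTheorem4 (γ : ℝ) (hγ0 : 0 < γ) (hγ1 : γ < 2 / Real.pi)
    (ψ : Chandrasekhar.L2R3) (hψ : Chandrasekhar.IsHydrogenEigenfunction γ ψ) :
    MeasureTheory.Integrable
        (Chandrasekhar.momentumDensity Chandrasekhar.kinetic ψ) MeasureTheory.volume ∧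
      MeasureTheory.Integrable
        (Chandrasekhar.momentumDensity Chandrasekhar.kineticDefect ψ) MeasureTheory.volume ∧
      Chandrasekhar.momentumExpectation Chandrasekhar.kinetic ψ ≤
        2 / Real.pi * Chandrasekhar.constA / (2 / Real.pi - γ) *
          Chandrasekhar.momentumExpectation Chandrasekhar.kineticDefect ψ := by
  obtain ⟨hne, E, hgraph⟩ := hψ
  obtain ⟨hf, hweak⟩ := Chandrasekhar.kineticForm_sub_coulombForm_of_graph hγ0 hγ1 hgraph
  have hf2 := Lp.memLp (𝓕 ψ : Chandrasekhar.L2R3)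
  have hpos := Chandrasekhar.integral_norm_sq_fourier_pos hne
  have heq := Chandrasekhar.ae_eigenvalue_equation hf hf2 hweak
  have hE : E = ((E.re : ℝ) : ℂ) :=
    Complex.ext rfl (Chandrasekhar.eigenvalue_im_eq_zero hf hf2 hpos heq)
  rw [hE] at heq
  refine ⟨hf.integrable_kinetic, Chandrasekhar.integrable_kineticDefect hf2, ?_⟩
  have hmain := Chandrasekhar.integral_kinetic_le hγ0 hγ1 hf hf2 heq hpos
  change ∫ ξ, Chandrasekhar.kinetic (Chandrasekhar.absMomentum ξ) *
      ‖(𝓕 ψ : Chandrasekhar.L2R3) ξ‖ ^ 2 ≤ _ *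
    ∫ ξ, Chandrasekhar.kineticDefect (Chandrasekhar.absMomentum ξ) *
      ‖(𝓕 ψ : Chandrasekhar.L2R3) ξ‖ ^ 2
  have hD : 0 ≤ ∫ ξ, Chandrasekhar.kineticDefect (Chandrasekhar.absMomentum ξ) *
      ‖(𝓕 ψ : Chandrasekhar.L2R3) ξ‖ ^ 2 :=
    integral_nonneg fun ξ => mul_nonneg (Chandrasekhar.kineticDefect_nonneg _) (by positivity)
  have hpi := Real.pi_pos
  have hc : 0 < 1 - γ * Real.pi / 2 := by
    have := (lt_div_iff₀ hpi).1 hγ1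
    linarith
  -- Cancelling `2/π` exposes the same factor `1 - γπ/2` as in `integral_kinetic_le`.
  have hconst : 2 / Real.pi * Chandrasekhar.constA / (2 / Real.pi - γ) =
      Chandrasekhar.constA / (1 - γ * Real.pi / 2) := by
    have h1 : 2 / Real.pi - γ = 2 / Real.pi * (1 - γ * Real.pi / 2) := by field_simp
    rw [h1, mul_div_mul_left _ _ (by positivity)]
  rw [hconst, div_mul_eq_mul_div, le_div_iff₀ hc, mul_comm]
  exact hmain.trans (mul_le_mul_of_nonneg_right Chandrasekhar.four_le_constA hD)
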